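/- Let $A\subseteq\mathbb{R}^n$ be a finite non-empty set of $N$ actions with $\|x\|_2\le B$ for all $x\in A$, where $B>0$. Let $\mu$ be a probability distribution on $A$ and $\lambda>0$ such that $\mathbb{E}_{y\sim\mu}[yy^{\top}]-\lambda I$ is positive semidefinite. Put $\gamma_t=\tfrac12 t^{-1/3}$ and $\eta_t=\gamma_t\lambda/B^2$ for $t\ge 1$. The algorithm ComBand proceeds in rounds $t=1,2,\dots$ as follows. Given the loss estimates $\hat L_1,\dots,\hat L_{t-1}\in\mathbb{R}^n$ of the earlier rounds, let $w_t(x)=\exp\bigl(-\eta_t\sum_{i=1}^{t-1}\hat L_i^{\top}x\bigr)$ and $p_t(x)=w_t(x)/\sum_{y\in A}w_t(y)$ for $x\in A$, and $q_t=(1-\gamma_t)p_t+\gamma_t\mu$. The algorithm plays an action $x_t\in A$ sampled from $q_t$, observes only the number $\ell_t=L_t^{\top}x_t$, and sets $\hat L_t=\ell_t\,C_t^{-1}x_t$ with $C_t=\mathbb{E}_{x\sim q_t}[xx^{\top}]$. The loss vectors $L_t\in\mathbb{R}^n$ are chosen by an adaptive, possibly randomized adversary: $L_t$ may depend on $x_1,L_1,\dots,x_{t-1},L_{t-1}$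 and on randomness of the adversary, and the conditional distribution of $x_t$ given $x_1,L_1,\dots,x_{t-1},L_{t-1},L_t$ is $q_t$. Assume that, almost surely, $|L_t^{\top}x|\le 1$ for all $t$ and all $x\in A$. Then there are absolute constants $C_1,C_2>0$ (independent of $n,A,N,B,\mu,\lambda$, the adversary, $T$ and $\delta$) such that for every $T\ge 1$ and every $0<\delta<1$, with probability at least $1-\delta$, the regret $$R_T=\sum_{t=1}^{T}L_t^{\top}x_t-\min_{x\in A}\sum_{t=1}^{T}L_t^{\top}x$$ satisfies both $$R_T\le\left(\frac{\sqrt3\,B}{\sqrt\lambda}\sqrt{\ln\frac{N+2}{\delta}}+n\,\frac{3(e-2)\lambda}{4B^2}+\frac32\right)T^{2/3}+C_1\left(n\frac{\lambda}{B^2}+\left(1+\frac{B^2}{\lambda}\right)\ln\frac{N+2}{\delta}\right)\sqrt T$$ and $$R_T\le C_2\left(\frac{B}{\sqrt\lambda}\sqrt{\ln\frac{N+2}{\delta}}+n\frac{\lambda}{B^2}\right)T^{2/3}.$$ -/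

import Mathlib

open MeasureTheory

noncomputable section

namespace ComBand

/-- The ambient space `ℝⁿ` with its Euclidean norm and scalar product. -/
abbrev Vec (n : ℕ) : Type := EuclideanSpace ℝ (Fin n)

/-- `ν` is (the probability mass function of) a probability distribution on the finite set `A`. -/
structure IsDistribution {n : ℕ} (A : Finset (Vec n)) (ν : Vec n → ℝ) : Prop where
  nonneg : ∀ x ∈ A, 0 ≤ ν x
  sum_eq_one : ∑ x ∈ A, ν x = 1

/-- The matrix `𝔼_{x ∼ q} [x xᵀ]` for a distribution `q` on `A`. -/
def secondMoment {n : ℕ} (A : Finset (Vec n)) (q : Vec n → ℝ) : Matrix (Fin n) (Fin n) ℝ :=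
  ∑ x ∈ A, q x • Matrix.vecMulVec x.ofLp x.ofLp

/-- The exponential weights distribution on `A` with learning rate `η`
and cumulative estimated loss vector `S`:
`p(x) = w(x) / W` with `w(x) = exp (- η Sᵀ x)` and `W = ∑_{y ∈ A} w(y)`. -/
def expWeights {n : ℕ} (A : Finset (Vec n)) (η : ℝ) (S x : Vec n) : ℝ :=
  Real.exp (-η * inner ℝ S x) / ∑ y ∈ A, Real.exp (-η * inner ℝ S y)

/-- The sampling distribution `q = (1 - γ) p + γ ν`, where `ν` is the exploration distribution. -/
def mixed {n : ℕ} (A : Finset (Vec n)) (ν : Vec n → ℝ) (γ η : ℝ) (S x : Vec n) : ℝ :=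
  (1 - γ) * expWeights A η S x + γ * ν x

/-- The loss estimator `ℓ C⁻¹ x` with `C = 𝔼_{y ∼ q} [y yᵀ]`,
for the played action `x` and the observed loss `ℓ`. -/
def lossEstimate {n : ℕ} (A : Finset (Vec n)) (q : Vec n → ℝ) (ℓ : ℝ) (x : Vec n) : Vec n :=
  WithLp.toLp 2 (ℓ • Matrix.mulVec (secondMoment A q)⁻¹ x.ofLp)

/-- The cumulative estimated loss vector after `k` rounds of the algorithm, for the
sequences `γ`, `η` of parameters, the played actions `xs` and the observed losses `ℓs`.
Rounds are numbered `0, 1, 2, …`. -/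
def cumEstimate {n : ℕ} (A : Finset (Vec n)) (ν : Vec n → ℝ) (γ η : ℕ → ℝ)
    (xs : ℕ → Vec n) (ℓs : ℕ → ℝ) : ℕ → Vec n
  | 0 => 0
  | k + 1 =>
    cumEstimate A ν γ η xs ℓs k +
      lossEstimate A (mixed A ν (γ k) (η k) (cumEstimate A ν γ η xs ℓs k)) (ℓs k) (xs k)

/-- The distribution from which the algorithm samples its action in round `k`, as a function of
the actions and observed losses of the earlier rounds. -/
def sampling {n : ℕ} (A : Finset (Vec n)) (ν : Vec n → ℝ) (γ η : ℕ → ℝ)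
    (xs : ℕ → Vec n) (ℓs : ℕ → ℝ) (k : ℕ) : Vec n → ℝ :=
  mixed A ν (γ k) (η k) (cumEstimate A ν γ η xs ℓs k)

/-- The σ-algebra generated by the actions and loss vectors of all rounds before round `k`
and by the loss vector of round `k`. -/
abbrev preHistory {n : ℕ} {Ω : Type*} (X L : ℕ → Ω → Vec n) (k : ℕ) : MeasurableSpace Ω :=
  (⨆ i : ℕ, ⨆ _ : i < k,
      MeasurableSpace.comap (X i) inferInstance ⊔ MeasurableSpace.comap (L i) inferInstance) ⊔
    MeasurableSpace.comap (L k) inferInstance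

/-- `X` (actions) and `L` (loss vectors) are the random outcomes of running the algorithm against
an adaptive, possibly randomized adversary: the loss vector of round `k` may depend in any way on
everything that happened before round `k` (and on randomness of the adversary), and, conditionally
on the past and on the current loss vector, the action of round `k` has the distribution `sampling`,
which is computed from the past actions and their observed losses `(L i)ᵀ (X i)` only. -/
structure IsRun {n : ℕ} (A : Finset (Vec n)) (ν : Vec n → ℝ) (γ η : ℕ → ℝ)
    {Ω : Type*} [MeasurableSpace Ω] (P : Measure Ω) (X L : ℕ → Ω → Vec n) : Prop where
  measurable_action : ∀ k, Measurable (X k)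
  measurable_loss : ∀ k, Measurable (L k)
  action_mem : ∀ k ω, X k ω ∈ A
  sample : ∀ k, ∀ a ∈ A,
    P[(X k ⁻¹' {a}).indicator (fun _ => (1 : ℝ)) | preHistory X L k] =ᵐ[P]
      fun ω => sampling A ν γ η (fun i => X i ω) (fun i => inner ℝ (L i ω) (X i ω)) k a

/-- The regret after `T` rounds of the actions `xs` for the loss vectors `Ls`,
relative to the best fixed action of `A` in hindsight. -/
def regret {n : ℕ} (A : Finset (Vec n)) (hA : A.Nonempty) (xs Ls : ℕ → Vec n) (T : ℕ) : ℝ :=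
  ∑ k ∈ Finset.range T, inner ℝ (Ls k) (xs k) -
    A.inf' hA fun x => ∑ k ∈ Finset.range T, inner ℝ (Ls k) x

/-- The exploration rate `t^(-1/3) / 2`; round `k` is the `t`-th round for `t = k + 1`. -/
def explorationRate (k : ℕ) : ℝ := ((k : ℝ) + 1) ^ (-(1 / 3) : ℝ) / 2

/-- The learning rate `γ lam / B ^ 2`, where `γ` is the exploration rate of the same round. -/
def learningRate (lam B : ℝ) (k : ℕ) : ℝ := explorationRate k * lam / B ^ 2

end ComBand

end

/-!
The regret against a fixed action `x` is the regret of exponential weights on the estimated losses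
`L̂ₜ` plus two fluctuations: the gap between the loss of the played action and the estimated loss of
the mean of `pₜ`, and the error of the estimator at `x`. Since `|ηₜ L̂ₜᵀ y| ≤ 1` on `A`, the
inequality `exp (-z) ≤ 1 - z + (e - 2) z²` for `z ≥ -1` bounds the regret of exponential weights by
`log N / η` plus `e - 2` times the sum of `ηₜ 𝔼_{pₜ} [(L̂ₜᵀ y)²]`; the decrease of `ηₜ` only helps,
because power means are monotone in the exponent. As `pₜ ≤ qₜ / (1 - γₜ)`, the second order term is
at most `ηₜ (1 - γₜ)⁻¹ xₜᵀ Cₜ⁻¹ xₜ`, whose conditional mean is `ηₜ (1 - γₜ)⁻¹ n` because the trace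
of `Cₜ⁻¹ Cₜ` is `n`.

Exploration gives `Cₜ ≥ γₜ λ`, which bounds the ranges and conditional variances of the
fluctuations, so Freedman's inequality at level `G = log ((N + 2) / δ)` and a union bound over
`N + 2` events control all of them. For `T^(1/3) < (B / √λ) √G` the second bound is weaker than
`R_T ≤ 2T`; otherwise the terms of order below `T^(2/3)` in the first bound are absorbed by its
leading term.
-/

namespace ComBand

lemma exp_sub_sum_le_pow_mul {y : ℝ} (hy₀ : 0 ≤ y) (hy₁ : y ≤ 1) (m : ℕ) :
    Real.exp y - ∑ i ∈ Finset.range m, y ^ i / i.factorial ≤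
      y ^ m * (Real.exp 1 - ∑ i ∈ Finset.range m, 1 / (i.factorial : ℝ)) := by
  have hasSum_tail (z : ℝ) : HasSum (fun i : ℕ => z ^ (i + m) / ((i + m).factorial : ℝ))
      (Real.exp z - ∑ i ∈ Finset.range m, z ^ i / i.factorial) := by
    rw [Real.exp_eq_exp_ℝ]
    exact (hasSum_nat_add_iff' m).mpr (NormedSpace.expSeries_div_hasSum_exp z)
  have hone := (hasSum_tail 1).mul_left (y ^ m)
  simp only [one_pow] at hone
  refine hasSum_le (fun i => ?_) (hasSum_tail y) hone
  rw [← mul_div_assoc, mul_one]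
  exact div_le_div_of_nonneg_right (pow_le_pow_of_le_one hy₀ hy₁ (Nat.le_add_left m i))
    (Nat.cast_nonneg _)

lemma exp_le_quadratic_of_nonpos {y : ℝ} (hy : y ≤ 0) : Real.exp y ≤ 1 + y + y ^ 2 / 2 := by
  have hpos : 0 < 1 + -y + (-y) ^ 2 / 2 := by nlinarith [sq_nonneg y]
  calc Real.exp y = (Real.exp (-y))⁻¹ := by rw [Real.exp_neg, inv_inv]
    _ ≤ (1 + -y + (-y) ^ 2 / 2)⁻¹ :=
        inv_anti₀ hpos (Real.quadratic_le_exp_of_nonneg (neg_nonneg.mpr hy))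
    _ ≤ 1 + y + y ^ 2 / 2 := by
        rw [inv_le_iff_one_le_mul₀ hpos]
        nlinarith [sq_nonneg (y ^ 2)]

lemma exp_le_one_add_add_mul_sq {y : ℝ} (hy : y ≤ 1) :
    Real.exp y ≤ 1 + y + (Real.exp 1 - 2) * y ^ 2 := by
  rcases le_total y 0 with h | h
  · nlinarith [exp_le_quadratic_of_nonpos h, Real.exp_one_gt_d9, sq_nonneg y]
  · have := exp_sub_sum_le_pow_mul h hy 2
    norm_num [Finset.sum_range_succ] at this
    linarith

lemma exp_le_one_add_add_sq_div_two_mul {y b : ℝ} (hb₀ : 0 ≤ b) (hb₁ : b ≤ 1) (hy : y ≤ b) :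
    Real.exp y ≤ 1 + y + y ^ 2 / 2 * (1 + b) := by
  rcases le_total y 0 with h | h
  · nlinarith [exp_le_quadratic_of_nonpos h, mul_nonneg (sq_nonneg y) hb₀]
  · have := exp_sub_sum_le_pow_mul h (hy.trans hb₁) 3
    norm_num [Finset.sum_range_succ, Nat.factorial] at this
    have hcubic : y ^ 3 * (Real.exp 1 - 5 / 2) ≤ y ^ 2 * b * (1 / 2) := by
      rw [pow_succ]
      gcongr
      · linarith [Real.exp_one_gt_d9]
      · linarith [Real.exp_one_lt_d9]
    linarith

lemma sum_rpow_sub_one_le {s : ℝ} (hs₀ : 0 < s) (hs₁ : s ≤ 1) (T : ℕ) :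
    ∑ k ∈ Finset.range T, ((k : ℝ) + 1) ^ (s - 1) ≤ (T : ℝ) ^ s / s := by
  induction T with
  | zero => simp [hs₀.ne']
  | succ T ih =>
    have hT : (0 : ℝ) < (T : ℝ) + 1 := by positivity
    have hx : -1 ≤ -((T : ℝ) + 1)⁻¹ := neg_le_neg (inv_le_one_of_one_le₀ (by linarith))
    have bernoulli := rpow_one_add_le_one_add_mul_self hx hs₀.le hs₁
    have hratio : 1 + -((T : ℝ) + 1)⁻¹ = T / (T + 1) := by field_simp; ring
    rw [hratio, Real.div_rpow (by positivity) hT.le, div_le_iff₀ (by positivity)] at bernoulli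
    rw [Finset.sum_range_succ, Nat.cast_succ, le_div_iff₀ hs₀]
    rw [le_div_iff₀ hs₀] at ih
    rw [Real.rpow_sub_one hT.ne', add_mul, div_eq_mul_inv]
    linarith

lemma sum_rpow_le {s : ℝ} (hs : 0 < s) (T : ℕ) :
    ∑ k ∈ Finset.range T, ((k : ℝ) + 1) ^ s ≤ (T : ℝ) ^ (s + 1) / (s + 1) + (T : ℝ) ^ s := by
  induction T with
  | zero => simp [hs.ne', (by linarith : s + 1 ≠ 0)]
  | succ T ih =>
    rcases T.eq_zero_or_pos with rfl | hT
    · simpa using by positivity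
    have hT' : (0 : ℝ) < T := by exact_mod_cast hT
    have bernoulli := one_add_mul_self_le_rpow_one_add (s := (T : ℝ)⁻¹)
      (by linarith [inv_pos.mpr hT']) (by linarith : 1 ≤ s + 1)
    have hratio : 1 + (T : ℝ)⁻¹ = (T + 1) / T := by field_simp
    rw [hratio, Real.div_rpow (by positivity) hT'.le, le_div_iff₀ (by positivity)] at bernoulli
    have hpow : (T : ℝ) ^ (s + 1) = T ^ s * T := Real.rpow_add_one hT'.ne' s
    have hinc : (T : ℝ) ^ (s + 1) / (s + 1) + (T : ℝ) ^ s ≤ ((T : ℝ) + 1) ^ (s + 1) / (s + 1) :=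
      calc (T : ℝ) ^ (s + 1) / (s + 1) + (T : ℝ) ^ s
          = (1 + (s + 1) * (T : ℝ)⁻¹) * T ^ (s + 1) / (s + 1) := by rw [hpow]; field_simp
        _ ≤ ((T : ℝ) + 1) ^ (s + 1) / (s + 1) := by gcongr
    rw [Finset.sum_range_succ, Nat.cast_succ]
    linarith

section ExponentialWeights

variable {ι : Type*}

/-- The probability weights on `A` proportional to `exp (-η * S x)`: exponential weights for an
arbitrary score `S`, not necessarily linear in the action. -/
noncomputable def softmin (A : Finset ι) (η : ℝ) (S : ι → ℝ) (x : ι) : ℝ :=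
  Real.exp (-η * S x) / ∑ y ∈ A, Real.exp (-η * S y)

/-- The free energy `-η⁻¹ log 𝔼 [exp (-η S)]` of a score `S` under the uniform distribution on `A`;
it is the potential of the exponential weights algorithm. -/
noncomputable def freeEnergy (A : Finset ι) (η : ℝ) (S : ι → ℝ) : ℝ :=
  -Real.log ((∑ x ∈ A, Real.exp (-η * S x)) / A.card) / η

variable {A : Finset ι} {η : ℝ} {S : ι → ℝ}

lemma sum_exp_pos (hA : A.Nonempty) : 0 < ∑ x ∈ A, Real.exp (-η * S x) :=
  Finset.sum_pos (fun _ _ => Real.exp_pos _) hA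

lemma softmin_nonneg (x : ι) : 0 ≤ softmin A η S x :=
  div_nonneg (Real.exp_pos _).le (Finset.sum_nonneg fun _ _ => (Real.exp_pos _).le)

lemma sum_softmin (hA : A.Nonempty) : ∑ x ∈ A, softmin A η S x = 1 := by
  simp only [softmin]
  rw [← Finset.sum_div, div_self (sum_exp_pos hA).ne']

lemma freeEnergy_zero (hA : A.Nonempty) : freeEnergy A η (fun _ => 0) = 0 := by
  have hcard : (A.card : ℝ) ≠ 0 := by exact_mod_cast hA.card_ne_zero
  simp [freeEnergy, hcard]

lemma freeEnergy_le (hη : 0 < η) {x : ι} (hx : x ∈ A) :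
    freeEnergy A η S ≤ S x + Real.log A.card / η := by
  have hA : A.Nonempty := ⟨x, hx⟩
  have hcard : (A.card : ℝ) ≠ 0 := by exact_mod_cast hA.card_ne_zero
  have hlog : -η * S x ≤ Real.log (∑ y ∈ A, Real.exp (-η * S y)) := by
    rw [Real.le_log_iff_exp_le (sum_exp_pos hA)]
    exact Finset.single_le_sum (f := fun y => Real.exp (-η * S y))
      (fun _ _ => (Real.exp_pos _).le) hx
  rw [freeEnergy, Real.log_div (sum_exp_pos hA).ne' hcard, div_le_iff₀ hη, add_mul,
    div_mul_cancel₀ _ hη.ne']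
  linarith

/- The power mean of `exp ∘ (-S)` with exponent `η` increases with `η`. -/
lemma freeEnergy_antitone (hA : A.Nonempty) {η' : ℝ} (hη' : 0 < η') (h : η' ≤ η) :
    freeEnergy A η S ≤ freeEnergy A η' S := by
  have hη : 0 < η := hη'.trans_le h
  have hcard : (0 : ℝ) < A.card := by exact_mod_cast hA.card_pos
  have hexp (x : ι) : Real.exp (-η' * S x) ^ (η / η') = Real.exp (-η * S x) := by
    rw [← Real.exp_mul]
    congr 1
    field_simp
  have hjensen : ((∑ x ∈ A, Real.exp (-η' * S x)) / A.card) ^ (η / η') ≤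
      (∑ x ∈ A, Real.exp (-η * S x)) / A.card := by
    have := Real.rpow_arith_mean_le_arith_mean_rpow A (fun _ => (A.card : ℝ)⁻¹)
      (fun x => Real.exp (-η' * S x)) (fun _ _ => by positivity)
      (by simp [hcard.ne']) (fun _ _ => (Real.exp_pos _).le) ((one_le_div hη').mpr h)
    simpa only [hexp, inv_mul_eq_div, ← Finset.sum_div] using this
  have hmean : 0 < (∑ x ∈ A, Real.exp (-η' * S x)) / A.card := div_pos (sum_exp_pos hA) hcard
  have hlog := Real.log_le_log (Real.rpow_pos_of_pos hmean _) hjensen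
  rw [Real.log_rpow hmean, div_mul_eq_mul_div, div_le_iff₀ hη'] at hlog
  rw [freeEnergy, freeEnergy, div_le_div_iff₀ hη hη']
  linarith

lemma sum_softmin_mul_le_freeEnergy_sub (hA : A.Nonempty) (hη : 0 < η) {z : ι → ℝ}
    (hz : ∀ x ∈ A, -1 ≤ η * z x) :
    ∑ x ∈ A, softmin A η S x * z x -
        (Real.exp 1 - 2) * (η * ∑ x ∈ A, softmin A η S x * z x ^ 2) ≤
      freeEnergy A η (fun x => S x + z x) - freeEnergy A η S := by
  set p := softmin A η S
  have hcard : (A.card : ℝ) ≠ 0 := by exact_mod_cast hA.card_ne_zero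
  have hratio : (∑ x ∈ A, Real.exp (-η * (S x + z x))) / ∑ x ∈ A, Real.exp (-η * S x) =
      ∑ x ∈ A, p x * Real.exp (-η * z x) := by
    rw [Finset.sum_div]
    refine Finset.sum_congr rfl fun x _ => ?_
    rw [mul_add, Real.exp_add, mul_div_right_comm]
    rfl
  have hexp : ∑ x ∈ A, p x * Real.exp (-η * z x) ≤
      1 - η * ∑ x ∈ A, p x * z x + (Real.exp 1 - 2) * η ^ 2 * ∑ x ∈ A, p x * z x ^ 2 :=
    calc ∑ x ∈ A, p x * Real.exp (-η * z x)
        ≤ ∑ x ∈ A, p x * (1 + -η * z x + (Real.exp 1 - 2) * (-η * z x) ^ 2) :=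
          Finset.sum_le_sum fun x hx => mul_le_mul_of_nonneg_left
            (exp_le_one_add_add_mul_sq (by linarith [hz x hx])) (softmin_nonneg x)
      _ = ∑ x ∈ A, p x - η * ∑ x ∈ A, p x * z x +
            (Real.exp 1 - 2) * η ^ 2 * ∑ x ∈ A, p x * z x ^ 2 := by
          rw [Finset.mul_sum, Finset.mul_sum, ← Finset.sum_sub_distrib, ← Finset.sum_add_distrib]
          exact Finset.sum_congr rfl fun x _ => by ring
      _ = _ := by rw [sum_softmin hA]
  have hlog : Real.log (∑ x ∈ A, p x * Real.exp (-η * z x)) ≤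
      -η * ∑ x ∈ A, p x * z x + (Real.exp 1 - 2) * η ^ 2 * ∑ x ∈ A, p x * z x ^ 2 := by
    rw [← hratio]
    have := Real.log_le_sub_one_of_pos
      (div_pos (sum_exp_pos (η := η) (S := fun x => S x + z x) hA)
        (sum_exp_pos (η := η) (S := S) hA))
    linarith
  rw [← hratio, Real.log_div (sum_exp_pos hA).ne' (sum_exp_pos hA).ne'] at hlog
  rw [freeEnergy, freeEnergy, ← sub_div, Real.log_div (sum_exp_pos hA).ne' hcard,
    Real.log_div (sum_exp_pos hA).ne' hcard, le_div_iff₀ hη]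
  linarith

theorem sum_softmin_mul_le {η : ℕ → ℝ} (hη : Antitone η) (hη₀ : ∀ k, 0 < η k) {z : ℕ → ι → ℝ}
    {T : ℕ} (hz : ∀ k < T, ∀ x ∈ A, -1 ≤ η k * z k x) {x : ι} (hx : x ∈ A) :
    let p := fun k => softmin A (η k) (fun y => ∑ i ∈ Finset.range k, z i y)
    ∑ k ∈ Finset.range T, ∑ y ∈ A, p k y * z k y ≤
      ∑ k ∈ Finset.range T, z k x + Real.log A.card / η T +
        (Real.exp 1 - 2) * ∑ k ∈ Finset.range T, η k * ∑ y ∈ A, p k y * z k y ^ 2 := by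
  intro p
  have hA : A.Nonempty := ⟨x, hx⟩
  have hpotential : ∀ t ≤ T, ∑ k ∈ Finset.range t, (∑ y ∈ A, p k y * z k y -
      (Real.exp 1 - 2) * (η k * ∑ y ∈ A, p k y * z k y ^ 2)) ≤
        freeEnergy A (η t) (fun y => ∑ i ∈ Finset.range t, z i y) := by
    intro t ht
    induction t with
    | zero => simp [freeEnergy_zero hA]
    | succ t ih =>
      have hstep := sum_softmin_mul_le_freeEnergy_sub
        (S := fun y => ∑ i ∈ Finset.range t, z i y) hA (hη₀ t) (hz t ht)
      have hmono := freeEnergy_antitone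
        (S := fun y => ∑ i ∈ Finset.range (t + 1), z i y) hA (hη₀ (t + 1)) (hη t.le_succ)
      simp only [Finset.sum_range_succ] at hmono ⊢
      linarith [ih (by omega)]
  have hfinal := (hpotential T le_rfl).trans (freeEnergy_le (hη₀ T) hx)
  rw [Finset.sum_sub_distrib, ← Finset.mul_sum] at hfinal
  linarith

end ExponentialWeights

section Freedman

variable {Ω : Type*} {mΩ : MeasurableSpace Ω} {P : Measure Ω}

lemma integral_prod_le_prod [IsProbabilityMeasure P] (ℱ : Filtration ℕ mΩ) {Z : ℕ → Ω → ℝ}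
    (hZ : ∀ k, StronglyMeasurable[ℱ (k + 1)] (Z k)) (hZ₀ : ∀ k, 0 ≤ Z k) {c a : ℕ → ℝ} {T : ℕ}
    (hc : ∀ k < T, ∀ᵐ ω ∂P, Z k ω ≤ c k) (ha : ∀ k < T, P[Z k | ℱ k] ≤ᵐ[P] fun _ => a k) :
    Integrable (∏ k ∈ Finset.range T, Z k) P ∧
      ∫ ω, (∏ k ∈ Finset.range T, Z k) ω ∂P ≤ ∏ k ∈ Finset.range T, a k := by
  induction T with
  | zero =>
    rw [Finset.prod_range_zero, Finset.prod_range_zero]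
    exact ⟨integrable_const 1, by simp⟩
  | succ T ih =>
    obtain ⟨hint, hle⟩ := ih (fun k hk => hc k (by omega)) (fun k hk => ha k (by omega))
    set Y := ∏ k ∈ Finset.range T, Z k
    have hY : StronglyMeasurable[ℱ T] Y := Finset.stronglyMeasurable_prod _ fun k hk =>
      (hZ k).mono (ℱ.mono (Finset.mem_range.mp hk))
    have hY₀ : 0 ≤ Y := Finset.prod_nonneg fun k _ => hZ₀ k
    have hZT : AEStronglyMeasurable (Z T) P := ((hZ T).mono (ℱ.le _)).aestronglyMeasurable
    have hbound : ∀ᵐ ω ∂P, ‖Z T ω‖ ≤ c T := (hc T T.lt_succ_self).mono fun ω hω => by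
      rwa [Real.norm_of_nonneg (hZ₀ T ω)]
    have hZint : Integrable (Z T) P := .of_bound hZT _ hbound
    have hYZ : Integrable (Y * Z T) P := hint.mul_bdd hZT hbound
    have ha₀ : 0 ≤ a T := by
      have hpos : 0 ≤ᵐ[P] P[Z T | ℱ T] := condExp_nonneg (.of_forall (hZ₀ T))
      obtain ⟨ω, h₁, h₂⟩ := (hpos.and (ha T T.lt_succ_self)).exists
      exact h₁.trans h₂
    rw [Finset.prod_range_succ, Finset.prod_range_succ]
    refine ⟨hYZ, ?_⟩
    calc ∫ ω, (Y * Z T) ω ∂P = ∫ ω, (P[Y * Z T | ℱ T]) ω ∂P := (integral_condExp (ℱ.le T)).symm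
      _ ≤ ∫ ω, Y ω * a T ∂P := by
          refine integral_mono_ae integrable_condExp (hint.mul_const _) ?_
          filter_upwards [condExp_mul_of_stronglyMeasurable_left hY hYZ hZint,
            ha T T.lt_succ_self] with ω hpull hω
          rw [hpull]
          exact mul_le_mul_of_nonneg_left hω (hY₀ ω)
      _ = (∫ ω, Y ω ∂P) * a T := integral_mul_const _ _
      _ ≤ _ := mul_le_mul_of_nonneg_right hle ha₀

lemma condExp_exp_mul_le [IsFiniteMeasure P] {m : MeasurableSpace Ω} (hm : m ≤ mΩ) {ξ : Ω → ℝ}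
    (hξ : MemLp ξ 2 P) {b : ℝ} (hb : 0 ≤ b) (hξb : ∀ᵐ ω ∂P, ξ ω ≤ b) {c v : ℝ}
    (hc : P[ξ | m] ≤ᵐ[P] fun _ => c) (hv : P[ξ ^ 2 | m] ≤ᵐ[P] fun _ => v) {s : ℝ} (hs : 0 ≤ s)
    (hsb : s * b ≤ 1) :
    P[fun ω => Real.exp (s * ξ ω) | m] ≤ᵐ[P]
      fun _ => Real.exp (s * c + s ^ 2 * (1 + s * b) / 2 * v) := by
  set κ := s ^ 2 * (1 + s * b) / 2 with hκ
  have hκ₀ : 0 ≤ κ := by positivity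
  have hint : Integrable ξ P := hξ.integrable one_le_two
  have hint_sq : Integrable (ξ ^ 2) P := hξ.integrable_sq
  have hint_exp : Integrable (fun ω => Real.exp (s * ξ ω)) P := by
    refine .of_bound
      (Real.continuous_exp.comp_aestronglyMeasurable (hint.const_mul s).aestronglyMeasurable)
      (Real.exp (s * b)) (hξb.mono fun ω hω => ?_)
    rw [Real.norm_eq_abs, Real.abs_exp]
    gcongr
  have hquad : (fun ω => Real.exp (s * ξ ω)) ≤ᵐ[P] (fun _ => 1) + s • ξ + κ • ξ ^ 2 := by
    filter_upwards [hξb] with ω hω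
    have := exp_le_one_add_add_sq_div_two_mul (mul_nonneg hs hb) hsb
      (mul_le_mul_of_nonneg_left hω hs)
    simp only [Pi.add_apply, Pi.smul_apply, Pi.pow_apply, smul_eq_mul, hκ]
    linarith
  have hlin : Integrable ((fun _ => (1 : ℝ)) + s • ξ) P := (integrable_const 1).add (hint.smul s)
  filter_upwards [condExp_mono (m := m) hint_exp (hlin.add (hint_sq.smul κ)) hquad,
    condExp_add hlin (hint_sq.smul κ) m, condExp_add (integrable_const 1) (hint.smul s) m,
    condExp_smul s ξ m, condExp_smul κ (ξ ^ 2) m, hc, hv]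
    with ω hmono hadd hadd' hsmul hsmul' hcω hvω
  rw [hadd, Pi.add_apply, hadd', Pi.add_apply, hsmul, hsmul', condExp_const hm] at hmono
  simp only [Pi.smul_apply, smul_eq_mul] at hmono
  have h₁ := mul_le_mul_of_nonneg_left hcω hs
  have h₂ := mul_le_mul_of_nonneg_left hvω hκ₀
  linarith [Real.add_one_le_exp (s * c + κ * v)]

/- The parameter is `s = √(2G) / (√V + b √(2G))`. -/
lemma exists_bernstein_parameter {b V G : ℝ} (hb : 0 < b) (hV : 0 ≤ V) (hG : 0 ≤ G) :
    ∃ s, 0 ≤ s ∧ s * b ≤ 1 ∧ s ^ 2 * (1 + s * b) / 2 * V + G ≤ s * (√(2 * V * G) + b * G) := by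
  obtain ⟨w, hw, rfl⟩ : ∃ w, 0 ≤ w ∧ V = w ^ 2 := ⟨√V, V.sqrt_nonneg, (Real.sq_sqrt hV).symm⟩
  obtain ⟨g, hg, rfl⟩ : ∃ g, 0 ≤ g ∧ G = g ^ 2 / 2 :=
    ⟨√(2 * G), Real.sqrt_nonneg _, by rw [Real.sq_sqrt (by positivity)]; ring⟩
  rcases hg.eq_or_lt with rfl | hg
  · exact ⟨0, by simp⟩
  have hsqrt : √(2 * w ^ 2 * (g ^ 2 / 2)) = w * g := by
    rw [show 2 * w ^ 2 * (g ^ 2 / 2) = (w * g) ^ 2 by ring, Real.sqrt_sq (by positivity)]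
  set D := w + b * g with hD
  have hD₀ : 0 < D := by positivity
  refine ⟨g / D, by positivity, ?_, ?_⟩
  · rw [div_mul_eq_mul_div, div_le_one hD₀]
    linarith
  · have hcubic : w ^ 2 * (D + b * g) ≤ D ^ 2 * w := by
      have : 0 ≤ w * (b * g) ^ 2 := by positivity
      rw [hD]
      linarith
    rw [hsqrt, ← sub_nonneg]
    have : g / D * (w * g + b * (g ^ 2 / 2)) -
        ((g / D) ^ 2 * (1 + g / D * b) / 2 * w ^ 2 + g ^ 2 / 2) =
          g ^ 2 / (2 * D ^ 3) * (D ^ 2 * w - w ^ 2 * (D + b * g)) := by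
      have hb_eq : b * g = D - w := by rw [hD]; ring
      field_simp
      linear_combination (D ^ 2) * hb_eq
    rw [this]
    exact mul_nonneg (by positivity) (sub_nonneg.mpr hcubic)

theorem freedman_inequality [IsProbabilityMeasure P] (ℱ : Filtration ℕ mΩ)
    {ξ : ℕ → Ω → ℝ} (hξ : ∀ k, StronglyMeasurable[ℱ (k + 1)] (ξ k)) {T : ℕ}
    (hξ₂ : ∀ k < T, MemLp (ξ k) 2 P) {b : ℝ} (hb : 0 < b) (hξb : ∀ k < T, ∀ᵐ ω ∂P, ξ k ω ≤ b)
    {m v : ℕ → ℝ} (hm : ∀ k < T, P[ξ k | ℱ k] ≤ᵐ[P] fun _ => m k)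
    (hv : ∀ k < T, P[ξ k ^ 2 | ℱ k] ≤ᵐ[P] fun _ => v k) {G : ℝ} (hG : 0 ≤ G) :
    P.real {ω | ∑ k ∈ Finset.range T, m k + √(2 * (∑ k ∈ Finset.range T, v k) * G) + b * G <
      ∑ k ∈ Finset.range T, ξ k ω} ≤ Real.exp (-G) := by
  set M := ∑ k ∈ Finset.range T, m k
  set V := ∑ k ∈ Finset.range T, v k
  have hV : 0 ≤ V := Finset.sum_nonneg fun k hk => by
    have hpos : 0 ≤ᵐ[P] P[ξ k ^ 2 | ℱ k] := condExp_nonneg (.of_forall fun ω => sq_nonneg _)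
    obtain ⟨ω, h₁, h₂⟩ := (hpos.and (hv k (Finset.mem_range.mp hk))).exists
    exact h₁.trans h₂
  obtain ⟨s, hs, hsb, hsG⟩ := exists_bernstein_parameter hb hV hG
  have hprod : (∏ k ∈ Finset.range T, fun ω => Real.exp (s * ξ k ω)) =
      fun ω => Real.exp (s * ∑ k ∈ Finset.range T, ξ k ω) := by
    ext ω
    rw [Finset.prod_apply, Finset.mul_sum, Real.exp_sum]
  obtain ⟨hint, hmgf⟩ := integral_prod_le_prod (P := P) ℱ (T := T)
    (Z := fun k ω => Real.exp (s * ξ k ω)) (c := fun _ => Real.exp (s * b))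
    (fun k => Real.continuous_exp.comp_stronglyMeasurable ((hξ k).const_mul s))
    (fun k ω => (Real.exp_pos _).le)
    (fun k hk => (hξb k hk).mono fun ω hω =>
      Real.exp_le_exp.mpr (mul_le_mul_of_nonneg_left hω hs))
    (fun k hk => condExp_exp_mul_le (ℱ.le k) (hξ₂ k hk) hb.le (hξb k hk) (hm k hk) (hv k hk) hs hsb)
  rw [hprod] at hint hmgf
  rw [← Real.exp_sum, Finset.sum_add_distrib, ← Finset.mul_sum, ← Finset.mul_sum] at hmgf
  calc P.real {ω | M + √(2 * V * G) + b * G < ∑ k ∈ Finset.range T, ξ k ω}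
      ≤ P.real {ω | M + √(2 * V * G) + b * G ≤ ∑ k ∈ Finset.range T, ξ k ω} :=
        measureReal_mono (Set.ofPred_subset_ofPred.mpr fun _ => le_of_lt)
    _ ≤ Real.exp (-s * (M + √(2 * V * G) + b * G)) *
          Real.exp (s * M + s ^ 2 * (1 + s * b) / 2 * V) :=
        (ProbabilityTheory.measure_ge_le_exp_mul_mgf _ hs hint).trans
          (mul_le_mul_of_nonneg_left hmgf (Real.exp_pos _).le)
    _ ≤ Real.exp (-G) := by
        rw [← Real.exp_add]
        exact Real.exp_le_exp.mpr (by linarith)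

lemma comp_eq_sum_indicator {α : Type*} {A : Finset α} {X : Ω → α} (hX : ∀ ω, X ω ∈ A)
    (f : α → Ω → ℝ) : (fun ω => f (X ω) ω) = ∑ a ∈ A, (X ⁻¹' {a}).indicator (f a) := by
  classical
  ext ω
  rw [Finset.sum_apply, Finset.sum_eq_single_of_mem (X ω) (hX ω)]
  · simp
  · intro a _ ha
    simp [ha.symm]

lemma condExp_comp_ae_eq_sum [IsFiniteMeasure P] {m : MeasurableSpace Ω} {α : Type*}
    {A : Finset α} {X : Ω → α} (hXA : ∀ ω, X ω ∈ A)
    (hX : ∀ a ∈ A, MeasurableSet[mΩ] (X ⁻¹' {a})) {q f : α → Ω → ℝ}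
    (hq : ∀ a ∈ A, P[(X ⁻¹' {a}).indicator (fun _ => (1 : ℝ)) | m] =ᵐ[P] q a)
    (hf : ∀ a ∈ A, StronglyMeasurable[m] (f a)) (hfi : ∀ a ∈ A, Integrable (f a) P) :
    P[fun ω => f (X ω) ω | m] =ᵐ[P] ∑ a ∈ A, q a * f a := by
  rw [comp_eq_sum_indicator hXA]
  refine (condExp_finsetSum (fun a ha => (hfi a ha).indicator (hX a ha)) m).trans
    (eventuallyEq_sum fun a ha => ?_)
  have hprod : (X ⁻¹' {a}).indicator (f a) = (X ⁻¹' {a}).indicator (fun _ => (1 : ℝ)) * f a := by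
    ext ω
    by_cases h : ω ∈ X ⁻¹' {a} <;> simp [h]
  rw [hprod]
  refine (condExp_mul_of_stronglyMeasurable_right (hf a ha) ?_ ?_).trans
    ((hq a ha).mul .rfl)
  · exact hprod ▸ (hfi a ha).indicator (hX a ha)
  · exact (integrable_const 1).indicator (hX a ha)

end Freedman

section SecondMoment

open scoped MatrixOrder

variable {n : ℕ} {A : Finset (Vec n)} {q : Vec n → ℝ} {c : ℝ}

lemma inner_eq_dotProduct (x y : Vec n) : inner ℝ x y = x.ofLp ⬝ᵥ y.ofLp := by
  rw [EuclideanSpace.inner_eq_star_dotProduct, dotProduct_comm, star_trivial]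

lemma dotProduct_secondMoment_mulVec (A : Finset (Vec n)) (q : Vec n → ℝ) (u v : Vec n) :
    u.ofLp ⬝ᵥ (Matrix.mulVec (secondMoment A q) v.ofLp) =
      ∑ x ∈ A, q x * (inner ℝ x u * inner ℝ x v) := by
  rw [secondMoment, Matrix.sum_mulVec, dotProduct_sum]
  refine Finset.sum_congr rfl fun x _ => ?_
  rw [Matrix.smul_mulVec, Matrix.vecMulVec_mulVec, dotProduct_smul, op_smul_eq_smul,
    dotProduct_smul, smul_eq_mul, smul_eq_mul, inner_eq_dotProduct, inner_eq_dotProduct,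
    dotProduct_comm x.ofLp u.ofLp, mul_comm (u.ofLp ⬝ᵥ x.ofLp)]

lemma secondMoment_mono {q' : Vec n → ℝ} (h : ∀ x ∈ A, q x ≤ q' x) :
    secondMoment A q ≤ secondMoment A q' := by
  refine Finset.sum_le_sum fun x hx => ?_
  rw [Matrix.le_iff, ← sub_smul]
  refine Matrix.PosSemidef.smul ?_ (sub_nonneg.mpr (h x hx))
  simpa using Matrix.posSemidef_vecMulVec_self_star x.ofLp

lemma secondMoment_const_mul (A : Finset (Vec n)) (r : ℝ) (q : Vec n → ℝ) :
    secondMoment A (fun x => r * q x) = r • secondMoment A q := by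
  simp only [secondMoment, Finset.smul_sum, mul_smul]

lemma secondMoment_transpose (A : Finset (Vec n)) (q : Vec n → ℝ) :
    (secondMoment A q).transpose = secondMoment A q := by
  simp only [secondMoment, Matrix.transpose_sum, Matrix.transpose_smul, Matrix.transpose_vecMulVec]

lemma trace_secondMoment (A : Finset (Vec n)) (q : Vec n → ℝ) :
    (secondMoment A q).trace = ∑ x ∈ A, q x * ‖x‖ ^ 2 := by
  simp only [secondMoment, Matrix.trace_sum, Matrix.trace_smul, Matrix.trace_vecMulVec,
    smul_eq_mul, ← inner_eq_dotProduct, real_inner_self_eq_norm_sq]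

lemma card_mul_le_sq (hC : c • 1 ≤ secondMoment A q) (hq : IsDistribution A q) {B : ℝ}
    (hB : ∀ x ∈ A, ‖x‖ ≤ B) : n * c ≤ B ^ 2 := by
  have htrace := (Matrix.le_iff.mp hC).trace_nonneg
  rw [Matrix.trace_sub, Matrix.trace_smul, Matrix.trace_one, Fintype.card_fin, smul_eq_mul,
    trace_secondMoment, sub_nonneg] at htrace
  calc n * c = c * n := mul_comm _ _
    _ ≤ ∑ x ∈ A, q x * ‖x‖ ^ 2 := htrace
    _ ≤ ∑ x ∈ A, q x * B ^ 2 := Finset.sum_le_sum fun x hx => mul_le_mul_of_nonneg_left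
        (pow_le_pow_left₀ (norm_nonneg x) (hB x hx) 2) (hq.nonneg x hx)
    _ = B ^ 2 := by rw [← Finset.sum_mul, hq.sum_eq_one, one_mul]

lemma mul_sq_norm_le (hC : c • 1 ≤ secondMoment A q) (u : Vec n) :
    c * ‖u‖ ^ 2 ≤ ∑ x ∈ A, q x * inner ℝ x u ^ 2 := by
  have h := (Matrix.le_iff.mp hC).dotProduct_mulVec_nonneg u.ofLp
  rw [star_trivial, Matrix.sub_mulVec, dotProduct_sub, dotProduct_secondMoment_mulVec,
    Matrix.smul_mulVec, Matrix.one_mulVec, dotProduct_smul, ← inner_eq_dotProduct,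
    real_inner_self_eq_norm_sq, smul_eq_mul, sub_nonneg] at h
  simpa only [sq (inner ℝ _ _)] using h

/-- The vector `C⁻¹ v` with `C = 𝔼_{y ∼ q} [y yᵀ]`, in terms of which the loss estimator is studied.
It is junk unless `C` is invertible. -/
noncomputable def invMoment (A : Finset (Vec n)) (q : Vec n → ℝ) (v : Vec n) : Vec n :=
  WithLp.toLp 2 (Matrix.mulVec (secondMoment A q)⁻¹ v.ofLp)

lemma inner_lossEstimate (A : Finset (Vec n)) (q : Vec n → ℝ) (ℓ : ℝ) (x u : Vec n) :
    inner ℝ (lossEstimate A q ℓ x) u = ℓ * inner ℝ u (invMoment A q x) := by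
  rw [real_inner_comm]
  simp only [inner_eq_dotProduct, lossEstimate, invMoment, dotProduct_smul, smul_eq_mul]

lemma inner_invMoment_comm (A : Finset (Vec n)) (q : Vec n → ℝ) (u v : Vec n) :
    inner ℝ u (invMoment A q v) = inner ℝ v (invMoment A q u) := by
  simp only [inner_eq_dotProduct, invMoment]
  rw [Matrix.dotProduct_mulVec, ← Matrix.mulVec_transpose, Matrix.transpose_nonsing_inv,
    secondMoment_transpose, dotProduct_comm]

section Invertible

variable (hc : 0 < c) (hC : c • 1 ≤ secondMoment A q)

include hc hC

lemma isUnit_det_secondMoment : IsUnit (secondMoment A q).det := by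
  have hpos : (secondMoment A q).PosDef := by
    rw [← sub_add_cancel (secondMoment A q) (c • 1)]
    exact Matrix.PosDef.posSemidef_add (Matrix.le_iff.mp hC) (Matrix.PosDef.one.smul hc)
  exact hpos.det_pos.ne'.isUnit

lemma sum_mul_inner_mul_inner_invMoment (u v : Vec n) :
    ∑ x ∈ A, q x * (inner ℝ x u * inner ℝ x (invMoment A q v)) = inner ℝ u v := by
  rw [← dotProduct_secondMoment_mulVec, invMoment, Matrix.mulVec_mulVec,
    Matrix.mul_nonsing_inv _ (isUnit_det_secondMoment hc hC), Matrix.one_mulVec,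
    inner_eq_dotProduct]

lemma sum_mul_inner_mul_inner_invMoment_left (L u : Vec n) :
    ∑ a ∈ A, q a * (inner ℝ L a * inner ℝ u (invMoment A q a)) = inner ℝ L u := by
  simpa only [real_inner_comm L, inner_invMoment_comm A q u] using
    sum_mul_inner_mul_inner_invMoment hc hC L u

lemma sum_mul_sq_inner_invMoment (u : Vec n) :
    ∑ x ∈ A, q x * inner ℝ x (invMoment A q u) ^ 2 = inner ℝ u (invMoment A q u) := by
  simp only [sq, sum_mul_inner_mul_inner_invMoment hc hC, real_inner_comm u]

lemma norm_invMoment_le (u : Vec n) : ‖invMoment A q u‖ ≤ ‖u‖ / c := by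
  have h := mul_sq_norm_le hC (invMoment A q u)
  rw [sum_mul_sq_inner_invMoment hc hC] at h
  rw [le_div_iff₀ hc]
  rcases (norm_nonneg (invMoment A q u)).eq_or_lt with h₀ | h₀
  · rw [← h₀, zero_mul]
    exact norm_nonneg u
  · refine le_of_mul_le_mul_right ?_ h₀
    linarith [real_inner_le_norm u (invMoment A q u)]

lemma abs_inner_invMoment_le {B : ℝ} {u v : Vec n} (hu : ‖u‖ ≤ B) (hv : ‖v‖ ≤ B) :
    |inner ℝ u (invMoment A q v)| ≤ B ^ 2 / c :=
  calc |inner ℝ u (invMoment A q v)| ≤ ‖u‖ * ‖invMoment A q v‖ := abs_real_inner_le_norm _ _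
    _ ≤ B * (B / c) := by
        gcongr
        · exact (norm_nonneg u).trans hu
        · exact (norm_invMoment_le hc hC v).trans (by gcongr)
    _ = B ^ 2 / c := by ring

/- `𝔼_{a ∼ q} [aᵀ C⁻¹ a]` is the trace of `C⁻¹ C`. -/
lemma sum_mul_inner_invMoment_self : ∑ a ∈ A, q a * inner ℝ a (invMoment A q a) = n := by
  have hterm (a : Vec n) : q a * inner ℝ a (invMoment A q a) =
      ((secondMoment A q)⁻¹ * (q a • Matrix.vecMulVec a.ofLp a.ofLp)).trace := by
    rw [Matrix.mul_smul, Matrix.mul_vecMulVec, Matrix.trace_smul, Matrix.trace_vecMulVec,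
      smul_eq_mul, inner_eq_dotProduct, dotProduct_comm, invMoment]
  rw [Finset.sum_congr rfl fun a _ => hterm a, ← Matrix.trace_sum, ← Matrix.mul_sum,
    ← secondMoment, Matrix.nonsing_inv_mul _ (isUnit_det_secondMoment hc hC), Matrix.trace_one,
    Fintype.card_fin]

end Invertible

lemma sq_sum_mul_le {ι : Type*} {s : Finset ι} {p f : ι → ℝ} (hp : ∀ i ∈ s, 0 ≤ p i)
    (hp₁ : ∑ i ∈ s, p i = 1) : (∑ i ∈ s, p i * f i) ^ 2 ≤ ∑ i ∈ s, p i * f i ^ 2 := by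
  simpa using (even_two.convexOn_pow (𝕜 := ℝ)).map_sum_le (p := f) hp hp₁
    fun _ _ => Set.mem_univ _

lemma sum_mul_sq_sub_mean_le {ι : Type*} {s : Finset ι} {p f : ι → ℝ} {m : ℝ}
    (hp₁ : ∑ i ∈ s, p i = 1) (hm : ∑ i ∈ s, p i * f i = m) :
    ∑ i ∈ s, p i * (f i - m) ^ 2 ≤ ∑ i ∈ s, p i * f i ^ 2 := by
  have hexpand : ∑ i ∈ s, p i * (f i - m) ^ 2 = ∑ i ∈ s, p i * f i ^ 2 -
      2 * m * ∑ i ∈ s, p i * f i + m ^ 2 * ∑ i ∈ s, p i := by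
    rw [Finset.mul_sum, Finset.mul_sum, ← Finset.sum_sub_distrib, ← Finset.sum_add_distrib]
    exact Finset.sum_congr rfl fun i _ => by ring
  rw [hexpand, hm, hp₁]
  linarith [sq_nonneg m]

/-- The mean `𝔼_{x ∼ p} [x]` of a distribution on `A`. -/
noncomputable def mean (A : Finset (Vec n)) (p : Vec n → ℝ) : Vec n := ∑ x ∈ A, p x • x

lemma inner_mean (A : Finset (Vec n)) (p : Vec n → ℝ) (u : Vec n) :
    inner ℝ u (mean A p) = ∑ x ∈ A, p x * inner ℝ u x := by
  simp only [mean, inner_sum, real_inner_smul_right]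

lemma norm_mean_le {p : Vec n → ℝ} (hp : IsDistribution A p) {B : ℝ} (hB : ∀ x ∈ A, ‖x‖ ≤ B) :
    ‖mean A p‖ ≤ B := by
  refine (norm_sum_le _ _).trans ?_
  rw [← one_mul B, ← hp.sum_eq_one, Finset.sum_mul]
  refine Finset.sum_le_sum fun x hx => ?_
  rw [norm_smul, Real.norm_of_nonneg (hp.nonneg x hx)]
  exact mul_le_mul_of_nonneg_left (hB x hx) (hp.nonneg x hx)

lemma abs_inner_mean_le {p : Vec n → ℝ} (hp : IsDistribution A p) {u : Vec n} {b : ℝ}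
    (hb : ∀ x ∈ A, |inner ℝ u x| ≤ b) : |inner ℝ u (mean A p)| ≤ b := by
  rw [inner_mean, ← one_mul b, ← hp.sum_eq_one, Finset.sum_mul]
  refine (Finset.abs_sum_le_sum_abs _ _).trans (Finset.sum_le_sum fun x hx => ?_)
  rw [abs_mul, abs_of_nonneg (hp.nonneg x hx)]
  exact mul_le_mul_of_nonneg_left (hb x hx) (hp.nonneg x hx)

lemma inner_mean_invMoment_mean_le (hc : 0 < c) (hC : c • 1 ≤ secondMoment A q) {p : Vec n → ℝ}
    (hp : IsDistribution A p) {κ : ℝ} (hκ : 0 ≤ κ) (hpq : ∀ x ∈ A, p x ≤ κ * q x) :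
    inner ℝ (mean A p) (invMoment A q (mean A p)) ≤ κ := by
  set u := mean A p
  have hsq : inner ℝ u (invMoment A q u) ^ 2 ≤ κ * inner ℝ u (invMoment A q u) :=
    calc inner ℝ u (invMoment A q u) ^ 2
        = (∑ x ∈ A, p x * inner ℝ x (invMoment A q u)) ^ 2 := by
          rw [real_inner_comm, inner_mean]
          simp only [real_inner_comm]
      _ ≤ ∑ x ∈ A, p x * inner ℝ x (invMoment A q u) ^ 2 := sq_sum_mul_le hp.nonneg hp.sum_eq_one
      _ ≤ ∑ x ∈ A, κ * q x * inner ℝ x (invMoment A q u) ^ 2 :=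
          Finset.sum_le_sum fun x hx => mul_le_mul_of_nonneg_right (hpq x hx) (sq_nonneg _)
      _ = κ * inner ℝ u (invMoment A q u) := by
          simp only [mul_assoc, ← Finset.mul_sum, sum_mul_sq_inner_invMoment hc hC]
  by_contra! h
  nlinarith [mul_pos (hκ.trans_lt h) (sub_pos.mpr h)]

end SecondMoment

section Round

open scoped MatrixOrder

variable {n : ℕ} {A : Finset (Vec n)} {ν p q : Vec n → ℝ} {B c κ γ η : ℝ} {S L : Vec n}

lemma isDistribution_expWeights (hA : A.Nonempty) : IsDistribution A (expWeights A η S) where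
  nonneg x _ := softmin_nonneg x
  sum_eq_one := sum_softmin hA

lemma IsDistribution.nonempty (hν : IsDistribution A ν) : A.Nonempty :=
  Finset.nonempty_of_sum_ne_zero (hν.sum_eq_one.trans_ne one_ne_zero)

lemma sum_mixed_mul (f : Vec n → ℝ) : ∑ x ∈ A, mixed A ν γ η S x * f x =
    (1 - γ) * ∑ x ∈ A, expWeights A η S x * f x + γ * ∑ x ∈ A, ν x * f x := by
  rw [Finset.mul_sum, Finset.mul_sum, ← Finset.sum_add_distrib]
  exact Finset.sum_congr rfl fun x _ => by rw [mixed]; ring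

lemma isDistribution_mixed (hν : IsDistribution A ν) (hγ₀ : 0 ≤ γ) (hγ₁ : γ ≤ 1) :
    IsDistribution A (mixed A ν γ η S) where
  nonneg x hx := add_nonneg (mul_nonneg (sub_nonneg.mpr hγ₁) (softmin_nonneg x))
    (mul_nonneg hγ₀ (hν.nonneg x hx))
  sum_eq_one := by
    simpa [(isDistribution_expWeights hν.nonempty).sum_eq_one, hν.sum_eq_one] using
      sum_mixed_mul (A := A) (ν := ν) (γ := γ) (η := η) (S := S) fun _ => 1

lemma expWeights_le_mixed (hν : IsDistribution A ν) (hγ₀ : 0 ≤ γ) (hγ₁ : γ < 1) {x : Vec n}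
    (hx : x ∈ A) : expWeights A η S x ≤ (1 - γ)⁻¹ * mixed A ν γ η S x := by
  rw [le_inv_mul_iff₀ (sub_pos.mpr hγ₁)]
  exact le_add_of_nonneg_right (mul_nonneg hγ₀ (hν.nonneg x hx))

lemma smul_one_le_secondMoment_mixed {lam : ℝ} (hν : lam • 1 ≤ secondMoment A ν) (hγ₀ : 0 ≤ γ)
    (hγ₁ : γ ≤ 1) : (γ * lam) • 1 ≤ secondMoment A (mixed A ν γ η S) :=
  calc (γ * lam) • 1 = γ • (lam • 1 : Matrix (Fin n) (Fin n) ℝ) := mul_smul _ _ _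
    _ ≤ γ • secondMoment A ν := by
        rw [Matrix.le_iff, ← smul_sub]
        exact (Matrix.le_iff.mp hν).smul hγ₀
    _ = secondMoment A (fun x => γ * ν x) := (secondMoment_const_mul A γ ν).symm
    _ ≤ secondMoment A (mixed A ν γ η S) := secondMoment_mono fun x _ =>
        le_add_of_nonneg_left (mul_nonneg (sub_nonneg.mpr hγ₁) (softmin_nonneg x))

/-- The difference between the loss of the played action `a` and the loss that the estimator built
from this observation assigns to the mean action of the distribution `p`. -/
noncomputable def exploitGap (A : Finset (Vec n)) (p q : Vec n → ℝ) (L a : Vec n) : ℝ :=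
  inner ℝ L a - inner ℝ (lossEstimate A q (inner ℝ L a) a) (mean A p)

/-- The error of the loss estimator for the action `x` when `a` is played. -/
noncomputable def estimateGap (A : Finset (Vec n)) (q : Vec n → ℝ) (L x a : Vec n) : ℝ :=
  inner ℝ (lossEstimate A q (inner ℝ L a) a) x - inner ℝ L x

/-- The upper bound `η (1 - γ)⁻¹ aᵀ C⁻¹ a` of the second order term of exponential weights in a
round with sampling distribution `q`, second moment matrix `C` and played action `a`. -/
noncomputable def secondOrder (A : Finset (Vec n)) (q : Vec n → ℝ) (γ η : ℝ) (a : Vec n) : ℝ :=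
  (1 - γ)⁻¹ * η * inner ℝ a (invMoment A q a)

lemma sum_mul_inner_lossEstimate (hc : 0 < c) (hC : c • 1 ≤ secondMoment A q) (L x : Vec n) :
    ∑ a ∈ A, q a * inner ℝ (lossEstimate A q (inner ℝ L a) a) x = inner ℝ L x := by
  simpa only [inner_lossEstimate] using sum_mul_inner_mul_inner_invMoment_left hc hC L x

lemma sum_mul_estimateGap (hc : 0 < c) (hC : c • 1 ≤ secondMoment A q) (hq : IsDistribution A q)
    (L x : Vec n) : ∑ a ∈ A, q a * estimateGap A q L x a = 0 := by
  simp only [estimateGap, mul_sub, Finset.sum_sub_distrib, ← Finset.sum_mul,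
    sum_mul_inner_lossEstimate hc hC, hq.sum_eq_one, one_mul, sub_self]

lemma sum_mul_exploitGap_mixed_le {lam : ℝ} (hlam : 0 < lam) (hν : IsDistribution A ν)
    (hνC : lam • 1 ≤ secondMoment A ν) (hγ₀ : 0 < γ) (hγ₁ : γ ≤ 1)
    (hL : ∀ x ∈ A, |inner ℝ L x| ≤ 1) :
    ∑ a ∈ A, mixed A ν γ η S a *
      exploitGap A (expWeights A η S) (mixed A ν γ η S) L a ≤ 2 * γ := by
  have hp : IsDistribution A (expWeights A η S) := isDistribution_expWeights hν.nonempty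
  simp only [exploitGap, mul_sub, Finset.sum_sub_distrib]
  rw [sum_mul_inner_lossEstimate (mul_pos hγ₀ hlam)
    (smul_one_le_secondMoment_mixed hνC hγ₀.le hγ₁), sum_mixed_mul, ← inner_mean, ← inner_mean]
  have hexplore := mul_le_mul_of_nonneg_left (abs_le.mp (abs_inner_mean_le hν hL)).2 hγ₀.le
  have hweights := mul_le_mul_of_nonneg_left (abs_le.mp (abs_inner_mean_le hp hL)).1 hγ₀.le
  linarith

section Bounds

variable (hc : 0 < c) (hC : c • 1 ≤ secondMoment A q)

include hc hC

lemma sum_mul_sq_inner_lossEstimate_le_inner_invMoment (hq : ∀ x ∈ A, 0 ≤ q x)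
    (hL : ∀ x ∈ A, |inner ℝ L x| ≤ 1) (x : Vec n) :
    ∑ a ∈ A, q a * inner ℝ (lossEstimate A q (inner ℝ L a) a) x ^ 2 ≤
      inner ℝ x (invMoment A q x) := by
  rw [← sum_mul_sq_inner_invMoment hc hC]
  refine Finset.sum_le_sum fun a ha => mul_le_mul_of_nonneg_left ?_ (hq a ha)
  rw [inner_lossEstimate, inner_invMoment_comm, mul_pow]
  exact mul_le_of_le_one_left (sq_nonneg _) ((sq_le_one_iff_abs_le_one _).mpr (hL a ha))

lemma sum_mul_sq_inner_lossEstimate_le_mul (hp : ∀ x ∈ A, 0 ≤ p x)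
    (hpq : ∀ x ∈ A, p x ≤ κ * q x) {ℓ : ℝ} (hℓ : |ℓ| ≤ 1) (a : Vec n) :
    ∑ x ∈ A, p x * inner ℝ (lossEstimate A q ℓ a) x ^ 2 ≤ κ * inner ℝ a (invMoment A q a) := by
  rw [← sum_mul_sq_inner_invMoment hc hC, Finset.mul_sum]
  refine Finset.sum_le_sum fun x hx => ?_
  rw [inner_lossEstimate, mul_pow]
  calc p x * (ℓ ^ 2 * inner ℝ x (invMoment A q a) ^ 2)
      ≤ p x * inner ℝ x (invMoment A q a) ^ 2 := mul_le_mul_of_nonneg_left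
        (mul_le_of_le_one_left (sq_nonneg _) ((sq_le_one_iff_abs_le_one ℓ).mpr hℓ)) (hp x hx)
    _ ≤ κ * q x * inner ℝ x (invMoment A q a) ^ 2 :=
        mul_le_mul_of_nonneg_right (hpq x hx) (sq_nonneg _)
    _ = κ * (q x * inner ℝ x (invMoment A q a) ^ 2) := mul_assoc _ _ _

lemma abs_inner_lossEstimate_le {ℓ : ℝ} (hℓ : |ℓ| ≤ 1) {a x : Vec n} (ha : ‖a‖ ≤ B)
    (hx : ‖x‖ ≤ B) : |inner ℝ (lossEstimate A q ℓ a) x| ≤ B ^ 2 / c := by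
  rw [inner_lossEstimate, abs_mul]
  exact (mul_le_of_le_one_left (abs_nonneg _) hℓ).trans
    (abs_inner_invMoment_le hc hC hx ha)

lemma abs_estimateGap_le (hB : ∀ x ∈ A, ‖x‖ ≤ B) (hL : ∀ x ∈ A, |inner ℝ L x| ≤ 1) {a x : Vec n}
    (ha : a ∈ A) (hx : x ∈ A) :
    |estimateGap A q L x a| ≤ B ^ 2 / c + 1 :=
  (abs_sub _ _).trans
    (add_le_add (abs_inner_lossEstimate_le hc hC (hL a ha) (hB a ha) (hB x hx)) (hL x hx))

lemma abs_exploitGap_le (hp : IsDistribution A p) (hB : ∀ x ∈ A, ‖x‖ ≤ B)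
    (hL : ∀ x ∈ A, |inner ℝ L x| ≤ 1) {a : Vec n} (ha : a ∈ A) :
    |exploitGap A p q L a| ≤ B ^ 2 / c + 1 := by
  rw [add_comm]
  exact (abs_sub _ _).trans (add_le_add (hL a ha)
    (abs_inner_lossEstimate_le hc hC (hL a ha) (hB a ha) (norm_mean_le hp hB)))

lemma sum_mul_sq_estimateGap_le (hq : IsDistribution A q) (hB : ∀ x ∈ A, ‖x‖ ≤ B)
    (hL : ∀ x ∈ A, |inner ℝ L x| ≤ 1) {x : Vec n} (hx : x ∈ A) :
    ∑ a ∈ A, q a * estimateGap A q L x a ^ 2 ≤ B ^ 2 / c :=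
  calc ∑ a ∈ A, q a * estimateGap A q L x a ^ 2
      ≤ ∑ a ∈ A, q a * inner ℝ (lossEstimate A q (inner ℝ L a) a) x ^ 2 :=
        sum_mul_sq_sub_mean_le hq.sum_eq_one (sum_mul_inner_lossEstimate hc hC L x)
    _ ≤ inner ℝ x (invMoment A q x) :=
        sum_mul_sq_inner_lossEstimate_le_inner_invMoment hc hC hq.nonneg hL x
    _ ≤ B ^ 2 / c := (le_abs_self _).trans (abs_inner_invMoment_le hc hC (hB x hx) (hB x hx))

lemma sum_mul_sq_exploitGap_le (hq : IsDistribution A q) (hp : IsDistribution A p) (hκ : 0 ≤ κ)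
    (hpq : ∀ x ∈ A, p x ≤ κ * q x) (hL : ∀ x ∈ A, |inner ℝ L x| ≤ 1) :
    ∑ a ∈ A, q a * exploitGap A p q L a ^ 2 ≤ 2 + 2 * κ := by
  set u := mean A p
  set e := fun a => inner ℝ (lossEstimate A q (inner ℝ L a) a) u
  have hsq (a : Vec n) (ha : a ∈ A) : exploitGap A p q L a ^ 2 ≤ 2 + 2 * e a ^ 2 := by
    have hloss : (inner ℝ L a) ^ 2 ≤ 1 := (sq_le_one_iff_abs_le_one _).mpr (hL a ha)
    change (inner ℝ L a - e a) ^ 2 ≤ _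
    linarith [sq_nonneg (inner ℝ L a + e a)]
  calc ∑ a ∈ A, q a * exploitGap A p q L a ^ 2
      ≤ ∑ a ∈ A, q a * (2 + 2 * e a ^ 2) :=
        Finset.sum_le_sum fun a ha => mul_le_mul_of_nonneg_left (hsq a ha) (hq.nonneg a ha)
    _ = 2 + 2 * ∑ a ∈ A, q a * e a ^ 2 := by
        simp only [mul_add, Finset.sum_add_distrib, ← Finset.sum_mul, hq.sum_eq_one,
          mul_left_comm _ (2 : ℝ), ← Finset.mul_sum, one_mul]
    _ ≤ 2 + 2 * inner ℝ u (invMoment A q u) := by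
        gcongr
        exact sum_mul_sq_inner_lossEstimate_le_inner_invMoment hc hC hq.nonneg hL u
    _ ≤ 2 + 2 * κ := by
        gcongr
        exact inner_mean_invMoment_mean_le hc hC hp hκ hpq

lemma sum_mul_secondOrder (γ η : ℝ) :
    ∑ a ∈ A, q a * secondOrder A q γ η a = (1 - γ)⁻¹ * η * n := by
  rw [← sum_mul_inner_invMoment_self hc hC, Finset.mul_sum]
  exact Finset.sum_congr rfl fun a _ => mul_left_comm _ _ _

lemma abs_secondOrder_le (hγ : γ < 1) (hη₀ : 0 ≤ η) (hη : η * (B ^ 2 / c) ≤ 1) {a : Vec n}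
    (ha : ‖a‖ ≤ B) : |secondOrder A q γ η a| ≤ (1 - γ)⁻¹ := by
  have hκ : 0 ≤ (1 - γ)⁻¹ := inv_nonneg.mpr (sub_pos.mpr hγ).le
  rw [secondOrder, mul_assoc, abs_mul, abs_of_nonneg hκ, abs_mul, abs_of_nonneg hη₀]
  exact mul_le_of_le_one_right hκ
    ((mul_le_mul_of_nonneg_left (abs_inner_invMoment_le hc hC ha ha) hη₀).trans hη)

end Bounds

lemma sum_mul_sq_le (hq : IsDistribution A q) {f : Vec n → ℝ} {b : ℝ}
    (hf : ∀ a ∈ A, |f a| ≤ b) : ∑ a ∈ A, q a * f a ^ 2 ≤ b ^ 2 := by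
  rw [← one_mul (b ^ 2), ← hq.sum_eq_one, Finset.sum_mul]
  exact Finset.sum_le_sum fun a ha => mul_le_mul_of_nonneg_left
    (sq_le_sq' (abs_le.mp (hf a ha)).1 (abs_le.mp (hf a ha)).2) (hq.nonneg a ha)

end Round

section Measurability

variable {n : ℕ} {Ω : Type*} {mΩ : MeasurableSpace Ω} {A : Finset (Vec n)} {ν : Vec n → ℝ}

lemma measurable_matrix_inv_apply (i j : Fin n) :
    Measurable fun M : Fin n → Fin n → ℝ => (Matrix.of M)⁻¹ i j := by
  simp only [Matrix.inv_def, Ring.inverse_eq_inv']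
  have hdet : Continuous fun M : Fin n → Fin n → ℝ => (Matrix.of M).det :=
    continuous_id.matrix_det
  have hadj : Continuous fun M : Fin n → Fin n → ℝ => (Matrix.of M).adjugate :=
    continuous_id.matrix_adjugate
  exact hdet.measurable.inv.mul (hadj.matrix_elem i j).measurable

lemma measurable_invMoment {q : Ω → Vec n → ℝ} {v : Ω → Vec n}
    (hq : ∀ a ∈ A, Measurable fun ω => q ω a) (hv : Measurable v) :
    Measurable fun ω => invMoment A (q ω) (v ω) := by
  have hC : Measurable fun ω => fun i j => secondMoment A (q ω) i j := by
    refine measurable_pi_iff.mpr fun i => measurable_pi_iff.mpr fun j => ?_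
    simp only [secondMoment, Matrix.sum_apply, Matrix.smul_apply, smul_eq_mul]
    exact Finset.measurable_sum _ fun a ha => (hq a ha).mul_const _
  refine (PiLp.continuous_toLp 2 _).measurable.comp (measurable_pi_iff.mpr fun i => ?_)
  simp only [Matrix.mulVec, dotProduct]
  exact Finset.measurable_sum _ fun j _ => ((measurable_matrix_inv_apply i j).comp hC).mul
    ((EuclideanSpace.proj (𝕜 := ℝ) j).continuous.measurable.comp hv)

lemma measurable_lossEstimate {q : Ω → Vec n → ℝ} {ℓ : Ω → ℝ} {x : Ω → Vec n}
    (hq : ∀ a ∈ A, Measurable fun ω => q ω a) (hℓ : Measurable ℓ) (hx : Measurable x) :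
    Measurable fun ω => lossEstimate A (q ω) (ℓ ω) (x ω) :=
  hℓ.smul (measurable_invMoment hq hx)

lemma measurable_expWeights {η : ℝ} {S : Ω → Vec n} (hS : Measurable S) (a : Vec n) :
    Measurable fun ω => expWeights A η (S ω) a := by
  have hexp (y : Vec n) : Measurable fun ω => Real.exp (-η * inner ℝ (S ω) y) :=
    Real.measurable_exp.comp ((hS.inner measurable_const).const_mul _)
  exact (hexp a).div (Finset.measurable_sum _ fun y _ => hexp y)

lemma measurable_mixed {γ η : ℝ} {S : Ω → Vec n} (hS : Measurable S) (a : Vec n) :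
    Measurable fun ω => mixed A ν γ η (S ω) a :=
  ((measurable_expWeights hS a).const_mul _).add_const _

lemma measurable_cumEstimate {γ η : ℕ → ℝ} {X : ℕ → Ω → Vec n} {ℓ : ℕ → Ω → ℝ} (k : ℕ)
    (hX : ∀ i < k, Measurable (X i)) (hℓ : ∀ i < k, Measurable (ℓ i)) :
    Measurable fun ω => cumEstimate A ν γ η (fun i => X i ω) (fun i => ℓ i ω) k := by
  induction k with
  | zero => exact measurable_const
  | succ k ih =>
    have hS := ih (fun i hi => hX i (hi.trans k.lt_succ_self))
      (fun i hi => hℓ i (hi.trans k.lt_succ_self))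
    exact hS.add (measurable_lossEstimate (fun a _ => measurable_mixed hS a)
      (hℓ k k.lt_succ_self) (hX k k.lt_succ_self))

lemma measurable_mean {p : Ω → Vec n → ℝ} (hp : ∀ a ∈ A, Measurable fun ω => p ω a) :
    Measurable fun ω => mean A (p ω) :=
  Finset.measurable_sum _ fun a ha => (hp a ha).smul_const a

lemma measurable_exploitGap {p q : Ω → Vec n → ℝ} {L : Ω → Vec n}
    (hp : ∀ a ∈ A, Measurable fun ω => p ω a) (hq : ∀ a ∈ A, Measurable fun ω => q ω a)
    (hL : Measurable L) (a : Vec n) : Measurable fun ω => exploitGap A (p ω) (q ω) (L ω) a :=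
  (hL.inner measurable_const).sub ((measurable_lossEstimate hq (hL.inner measurable_const)
    measurable_const).inner (measurable_mean hp))

lemma measurable_estimateGap {q : Ω → Vec n → ℝ} {L : Ω → Vec n}
    (hq : ∀ a ∈ A, Measurable fun ω => q ω a) (hL : Measurable L) (x a : Vec n) :
    Measurable fun ω => estimateGap A (q ω) (L ω) x a :=
  ((measurable_lossEstimate hq (hL.inner measurable_const) measurable_const).inner
    measurable_const).sub (hL.inner measurable_const)

lemma measurable_secondOrder {q : Ω → Vec n → ℝ} {γ η : ℝ}
    (hq : ∀ a ∈ A, Measurable fun ω => q ω a) (a : Vec n) :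
    Measurable fun ω => secondOrder A (q ω) γ η a :=
  (measurable_const.inner (measurable_invMoment hq measurable_const)).const_mul _

end Measurability

section PreHistory

variable {n : ℕ} {Ω : Type*} {X L : ℕ → Ω → Vec n}

lemma measurable_action_preHistory {i k : ℕ} (h : i < k) : Measurable[preHistory X L k] (X i) :=
  Measurable.of_comap_le <| le_sup_of_le_left <| le_sup_left.trans <| le_iSup₂_of_le
    (f := fun i (_ : i < k) =>
      MeasurableSpace.comap (X i) inferInstance ⊔ MeasurableSpace.comap (L i) inferInstance)
    i h le_rfl

lemma measurable_loss_preHistory {i k : ℕ} (h : i ≤ k) : Measurable[preHistory X L k] (L i) := by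
  refine Measurable.of_comap_le ?_
  rcases h.eq_or_lt with rfl | h
  · exact le_sup_right
  · exact le_sup_of_le_left <| le_sup_right.trans <| le_iSup₂_of_le
      (f := fun i (_ : i < k) =>
        MeasurableSpace.comap (X i) inferInstance ⊔ MeasurableSpace.comap (L i) inferInstance)
      i h le_rfl

lemma preHistory_le_of_measurable {m : MeasurableSpace Ω} {k : ℕ}
    (hX : ∀ i < k, Measurable[m] (X i)) (hL : ∀ i ≤ k, Measurable[m] (L i)) :
    preHistory X L k ≤ m :=
  sup_le (iSup₂_le fun i hi => sup_le (hX i hi).comap_le (hL i hi.le).comap_le)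
    (hL k le_rfl).comap_le

lemma preHistory_mono : Monotone (preHistory X L) := fun _ _ h => preHistory_le_of_measurable
  (fun _ hi => measurable_action_preHistory (hi.trans_le h))
  (fun _ hi => measurable_loss_preHistory (hi.trans h))

end PreHistory

section Path

variable {n : ℕ}

/-- The cumulative estimated loss vector before round `k` when the actions `xs` are played and
the adversary chooses the loss vectors `Ls`. -/
noncomputable def pathEstimate (A : Finset (Vec n)) (ν : Vec n → ℝ) (γ η : ℕ → ℝ)
    (xs Ls : ℕ → Vec n) (k : ℕ) : Vec n :=
  cumEstimate A ν γ η xs (fun i => inner ℝ (Ls i) (xs i)) k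

/-- The exponential weights distribution of round `k` when the actions `xs` are played and
the adversary chooses the loss vectors `Ls`. -/
noncomputable def pathWeights (A : Finset (Vec n)) (ν : Vec n → ℝ) (γ η : ℕ → ℝ)
    (xs Ls : ℕ → Vec n) (k : ℕ) : Vec n → ℝ :=
  expWeights A (η k) (pathEstimate A ν γ η xs Ls k)

/-- The sampling distribution of round `k` when the actions `xs` are played and
the adversary chooses the loss vectors `Ls`. -/
noncomputable def pathSampling (A : Finset (Vec n)) (ν : Vec n → ℝ) (γ η : ℕ → ℝ)
    (xs Ls : ℕ → Vec n) (k : ℕ) : Vec n → ℝ :=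
  sampling A ν γ η xs (fun i => inner ℝ (Ls i) (xs i)) k

variable {Ω : Type*} {A : Finset (Vec n)} {ν : Vec n → ℝ} {γ η : ℕ → ℝ} {X L : ℕ → Ω → Vec n}

lemma measurable_pathEstimate (k : ℕ) :
    Measurable[preHistory X L k] fun ω => pathEstimate A ν γ η (X · ω) (L · ω) k :=
  measurable_cumEstimate k (fun _ hi => measurable_action_preHistory hi) fun _ hi =>
    (measurable_loss_preHistory hi.le).inner (measurable_action_preHistory hi)

lemma measurable_pathWeights (k : ℕ) (a : Vec n) :
    Measurable[preHistory X L k] fun ω => pathWeights A ν γ η (X · ω) (L · ω) k a :=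
  measurable_expWeights (measurable_pathEstimate k) a

lemma measurable_pathSampling (k : ℕ) (a : Vec n) :
    Measurable[preHistory X L k] fun ω => pathSampling A ν γ η (X · ω) (L · ω) k a :=
  measurable_mixed (measurable_pathEstimate k) a

end Path

section Run

variable {n : ℕ} {A : Finset (Vec n)} {ν : Vec n → ℝ} {γ η : ℕ → ℝ} {Ω : Type*}
  {mΩ : MeasurableSpace Ω} {P : Measure Ω} {X L : ℕ → Ω → Vec n}

/-- The filtration of the σ-algebras `preHistory X L k` of a run. -/
def IsRun.filtration (hrun : IsRun A ν γ η P X L) : Filtration ℕ mΩ where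
  seq := preHistory X L
  mono' := preHistory_mono
  le' _ := preHistory_le_of_measurable (fun i _ => hrun.measurable_action i)
    (fun i _ => hrun.measurable_loss i)

lemma IsRun.measurable_comp_action (hrun : IsRun A ν γ η P X L) {k : ℕ} {f : Vec n → Ω → ℝ}
    (hf : ∀ a ∈ A, Measurable[preHistory X L k] (f a)) :
    Measurable[preHistory X L (k + 1)] fun ω => f (X k ω) ω := by
  rw [comp_eq_sum_indicator (hrun.action_mem k), Finset.sum_fn]
  exact Finset.measurable_sum _ fun a ha => ((hf a ha).mono (preHistory_mono k.le_succ) le_rfl)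
    |>.indicator (measurable_action_preHistory k.lt_succ_self (measurableSet_singleton a))

lemma IsRun.condExp_comp_action_ae_eq [IsFiniteMeasure P] (hrun : IsRun A ν γ η P X L) {k : ℕ}
    {f : Vec n → Ω → ℝ} (hf : ∀ a ∈ A, Measurable[preHistory X L k] (f a)) {b : ℝ}
    (hfb : ∀ᵐ ω ∂P, ∀ a ∈ A, |f a ω| ≤ b) :
    P[fun ω => f (X k ω) ω | preHistory X L k] =ᵐ[P] fun ω =>
      ∑ a ∈ A, pathSampling A ν γ η (X · ω) (L · ω) k a * f a ω := by
  have hint (a : Vec n) (ha : a ∈ A) : Integrable (f a) P :=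
    Integrable.of_bound ((hf a ha).mono (hrun.filtration.le k) le_rfl).aestronglyMeasurable b
      (hfb.mono fun ω hω => hω a ha)
  refine (condExp_comp_ae_eq_sum (hrun.action_mem k)
    (fun a _ => hrun.measurable_action k (measurableSet_singleton a)) (hrun.sample k)
    (fun a ha => (hf a ha).stronglyMeasurable) hint).trans (.of_eq ?_)
  ext ω
  rw [Finset.sum_apply]
  rfl

lemma IsRun.freedman_inequality [IsProbabilityMeasure P] (hrun : IsRun A ν γ η P X L)
    {f : ℕ → Vec n → Ω → ℝ} (hf : ∀ k, ∀ a ∈ A, Measurable[preHistory X L k] (f k a)) {T : ℕ}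
    {b G : ℝ} {m v : ℕ → ℝ} (hb : 0 < b) (hfb : ∀ k < T, ∀ᵐ ω ∂P, ∀ a ∈ A, |f k a ω| ≤ b)
    (hm : ∀ k < T, ∀ᵐ ω ∂P,
      ∑ a ∈ A, pathSampling A ν γ η (X · ω) (L · ω) k a * f k a ω ≤ m k)
    (hv : ∀ k < T, ∀ᵐ ω ∂P,
      ∑ a ∈ A, pathSampling A ν γ η (X · ω) (L · ω) k a * f k a ω ^ 2 ≤ v k) (hG : 0 ≤ G) :
    P.real {ω | ∑ k ∈ Finset.range T, m k + √(2 * (∑ k ∈ Finset.range T, v k) * G) + b * G <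
      ∑ k ∈ Finset.range T, f k (X k ω) ω} ≤ Real.exp (-G) := by
  have hmeas (k : ℕ) := hrun.measurable_comp_action (hf k)
  refine ComBand.freedman_inequality hrun.filtration (fun k => (hmeas k).stronglyMeasurable)
    (fun k hk => ?_) hb (fun k hk => ?_) (fun k hk => ?_) (fun k hk => ?_) hG
  · exact MemLp.of_bound ((hmeas k).mono (hrun.filtration.le _) le_rfl).aestronglyMeasurable b
      ((hfb k hk).mono fun ω hω => hω _ (hrun.action_mem k ω))
  · exact (hfb k hk).mono fun ω hω => (le_abs_self _).trans (hω _ (hrun.action_mem k ω))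
  · filter_upwards [hrun.condExp_comp_action_ae_eq (hf k) (hfb k hk), hm k hk] with ω hω hle
    exact hω.trans_le hle
  · have hsq : ∀ᵐ ω ∂P, ∀ a ∈ A, |f k a ω ^ 2| ≤ b ^ 2 := (hfb k hk).mono fun ω hω a ha => by
      simpa only [abs_pow] using pow_le_pow_left₀ (abs_nonneg _) (hω a ha) 2
    filter_upwards [hrun.condExp_comp_action_ae_eq (fun a ha => (hf k a ha).pow_const 2) hsq,
      hv k hk] with ω hω hle
    exact hω.trans_le hle

end Run

open scoped MatrixOrder in
/-- The standing assumptions: the actions in `A` have norm at most `B`, the second moment matrix of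
the exploration distribution `ν` is at least `lam`, the exploration rates `γ` are nonincreasing with
values in `(0, 1/2]`, and the learning rates `η` are proportional to them. -/
structure IsAdmissible {n : ℕ} (A : Finset (Vec n)) (ν : Vec n → ℝ) (B lam : ℝ) (γ η : ℕ → ℝ) :
    Prop where
  norm_le : ∀ x ∈ A, ‖x‖ ≤ B
  bound_pos : 0 < B
  lam_pos : 0 < lam
  isDistribution : IsDistribution A ν
  smul_one_le : lam • 1 ≤ secondMoment A ν
  antitone : Antitone γ
  pos : ∀ k, 0 < γ k
  le_half : ∀ k, γ k ≤ 1 / 2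
  learning_eq : ∀ k, η k = γ k * lam / B ^ 2

section Admissible

open scoped MatrixOrder

variable {n : ℕ} {A : Finset (Vec n)} {ν : Vec n → ℝ} {B lam : ℝ} {γ η : ℕ → ℝ}
  {xs Ls : ℕ → Vec n}

namespace IsAdmissible

section Rates

variable (h : IsAdmissible A ν B lam γ η) (k : ℕ)

include h

lemma lt_one : γ k < 1 := (h.le_half k).trans_lt (by norm_num)

lemma inv_one_sub_nonneg : 0 ≤ (1 - γ k)⁻¹ := inv_nonneg.mpr (sub_pos.mpr (h.lt_one k)).le

lemma inv_one_sub_le : (1 - γ k)⁻¹ ≤ 2 :=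
  inv_le_of_inv_le₀ two_pos (by linarith [h.le_half k])

lemma mul_pos : 0 < γ k * lam := _root_.mul_pos (h.pos k) h.lam_pos

lemma learning_pos : 0 < η k := h.learning_eq k ▸ div_pos (h.mul_pos k) (pow_pos h.bound_pos 2)

lemma sq_div_mul : B ^ 2 / (γ k * lam) = (η k)⁻¹ := by rw [h.learning_eq, inv_div]

lemma learning_mul_sq_div : η k * (B ^ 2 / (γ k * lam)) = 1 := by
  rw [h.sq_div_mul, mul_inv_cancel₀ (h.learning_pos k).ne']

lemma learning_antitone : Antitone η := fun i j hij => by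
  rw [h.learning_eq, h.learning_eq]
  exact div_le_div_of_nonneg_right
    (mul_le_mul_of_nonneg_right (h.antitone hij) h.lam_pos.le) (sq_nonneg B)

lemma inv_learning_le {T : ℕ} (hk : k < T) : (η k)⁻¹ ≤ (η T)⁻¹ :=
  inv_anti₀ (h.learning_pos T) (h.learning_antitone hk.le)

lemma isDistribution_pathWeights : IsDistribution A (pathWeights A ν γ η xs Ls k) :=
  isDistribution_expWeights h.isDistribution.nonempty

lemma isDistribution_pathSampling : IsDistribution A (pathSampling A ν γ η xs Ls k) :=
  isDistribution_mixed h.isDistribution (h.pos k).le (h.lt_one k).le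

lemma smul_one_le_secondMoment_pathSampling :
    (γ k * lam) • 1 ≤ secondMoment A (pathSampling A ν γ η xs Ls k) :=
  smul_one_le_secondMoment_mixed h.smul_one_le (h.pos k).le (h.lt_one k).le

lemma pathWeights_le (x : Vec n) (hx : x ∈ A) : pathWeights A ν γ η xs Ls k x ≤
    (1 - γ k)⁻¹ * pathSampling A ν γ η xs Ls k x :=
  expWeights_le_mixed h.isDistribution (h.pos k).le (h.lt_one k) hx

end Rates

end IsAdmissible

/-- The bounds, at confidence level `G`, on the three fluctuation terms of the regret of the actions
`xs` against the loss vectors `Ls`. -/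
structure DeviationBounds (A : Finset (Vec n)) (ν : Vec n → ℝ) (γ η : ℕ → ℝ) (T : ℕ) (G : ℝ)
    (xs Ls : ℕ → Vec n) : Prop where
  exploit : ∑ k ∈ Finset.range T, exploitGap A (pathWeights A ν γ η xs Ls k)
      (pathSampling A ν γ η xs Ls k) (Ls k) (xs k) ≤
    ∑ k ∈ Finset.range T, 2 * γ k + √(2 * (T * 6) * G) + ((η T)⁻¹ + 1) * G
  secondOrder : ∑ k ∈ Finset.range T,
      secondOrder A (pathSampling A ν γ η xs Ls k) (γ k) (η k) (xs k) ≤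
    ∑ k ∈ Finset.range T, (1 - γ k)⁻¹ * η k * n + √(2 * (T * 4) * G) + 2 * G
  estimate : ∀ x ∈ A, ∑ k ∈ Finset.range T,
      estimateGap A (pathSampling A ν γ η xs Ls k) (Ls k) x (xs k) ≤
    √(2 * (∑ k ∈ Finset.range T, (η k)⁻¹) * G) + ((η T)⁻¹ + 1) * G

variable {Ω : Type*} {mΩ : MeasurableSpace Ω} {P : Measure Ω} [IsProbabilityMeasure P]
  {X L : ℕ → Ω → Vec n}

section Deviations

variable (h : IsAdmissible A ν B lam γ η) (hrun : IsRun A ν γ η P X L) {T : ℕ} {G : ℝ}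

include h hrun

lemma IsRun.measureReal_exploitGap_le
    (hL : ∀ᵐ ω ∂P, ∀ k, ∀ x ∈ A, |inner ℝ (L k ω) x| ≤ 1) (hG : 0 ≤ G) :
    P.real {ω | ∑ k ∈ Finset.range T, 2 * γ k + √(2 * (T * 6) * G) + ((η T)⁻¹ + 1) * G <
      ∑ k ∈ Finset.range T, exploitGap A (pathWeights A ν γ η (X · ω) (L · ω) k)
        (pathSampling A ν γ η (X · ω) (L · ω) k) (L k ω) (X k ω)} ≤ Real.exp (-G) := by
  have hfreedman := hrun.freedman_inequality (T := T) (G := G) (b := (η T)⁻¹ + 1)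
    (f := fun k a ω => exploitGap A (pathWeights A ν γ η (X · ω) (L · ω) k)
      (pathSampling A ν γ η (X · ω) (L · ω) k) (L k ω) a)
    (m := fun k => 2 * γ k) (v := fun _ => 6)
    (fun k a _ => measurable_exploitGap (fun x _ => measurable_pathWeights k x)
      (fun x _ => measurable_pathSampling k x) (measurable_loss_preHistory le_rfl) a)
    (add_pos (inv_pos.mpr (h.learning_pos T)) one_pos)
    (fun k hk => hL.mono fun ω hω a ha =>
      (abs_exploitGap_le (h.mul_pos k) (h.smul_one_le_secondMoment_pathSampling k)
        (h.isDistribution_pathWeights k) h.norm_le (hω k) ha).trans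
        (by rw [h.sq_div_mul]; linarith [h.inv_learning_le k hk]))
    (fun k _ => hL.mono fun ω hω => sum_mul_exploitGap_mixed_le h.lam_pos h.isDistribution
      h.smul_one_le (h.pos k) (h.lt_one k).le (hω k))
    (fun k _ => hL.mono fun ω hω =>
      (sum_mul_sq_exploitGap_le (h.mul_pos k) (h.smul_one_le_secondMoment_pathSampling k)
        (h.isDistribution_pathSampling k) (h.isDistribution_pathWeights k)
        (h.inv_one_sub_nonneg k) (h.pathWeights_le k) (hω k)).trans
        (by linarith [h.inv_one_sub_le k])) hG
  simpa only [Finset.sum_const, Finset.card_range, nsmul_eq_mul] using hfreedman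

lemma IsRun.measureReal_secondOrder_le (hG : 0 ≤ G) :
    P.real {ω | ∑ k ∈ Finset.range T, (1 - γ k)⁻¹ * η k * n + √(2 * (T * 4) * G) + 2 * G <
      ∑ k ∈ Finset.range T, secondOrder A (pathSampling A ν γ η (X · ω) (L · ω) k) (γ k) (η k)
        (X k ω)} ≤ Real.exp (-G) := by
  have hbound (k : ℕ) (ω : Ω) (a : Vec n) (ha : a ∈ A) :
      |secondOrder A (pathSampling A ν γ η (X · ω) (L · ω) k) (γ k) (η k) a| ≤ 2 :=
    (abs_secondOrder_le (h.mul_pos k) (h.smul_one_le_secondMoment_pathSampling k) (h.lt_one k)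
      (h.learning_pos k).le (h.learning_mul_sq_div k).le (h.norm_le a ha)).trans
      (h.inv_one_sub_le k)
  have hfreedman := hrun.freedman_inequality (T := T) (G := G) (b := 2)
    (f := fun k a ω => secondOrder A (pathSampling A ν γ η (X · ω) (L · ω) k) (γ k) (η k) a)
    (m := fun k => (1 - γ k)⁻¹ * η k * n) (v := fun _ => 4)
    (fun k a _ => measurable_secondOrder (fun x _ => measurable_pathSampling k x) a) two_pos
    (fun k _ => .of_forall (hbound k))
    (fun k _ => .of_forall fun ω => (sum_mul_secondOrder (h.mul_pos k)
      (h.smul_one_le_secondMoment_pathSampling k) _ _).le)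
    (fun k _ => .of_forall fun ω => (sum_mul_sq_le (h.isDistribution_pathSampling k)
      (hbound k ω)).trans (by norm_num)) hG
  simpa only [Finset.sum_const, Finset.card_range, nsmul_eq_mul] using hfreedman

lemma IsRun.measureReal_estimateGap_le
    (hL : ∀ᵐ ω ∂P, ∀ k, ∀ x ∈ A, |inner ℝ (L k ω) x| ≤ 1) (hG : 0 ≤ G) {x : Vec n}
    (hx : x ∈ A) :
    P.real {ω | √(2 * (∑ k ∈ Finset.range T, (η k)⁻¹) * G) + ((η T)⁻¹ + 1) * G <
      ∑ k ∈ Finset.range T, estimateGap A (pathSampling A ν γ η (X · ω) (L · ω) k) (L k ω) x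
        (X k ω)} ≤ Real.exp (-G) := by
  have hfreedman := hrun.freedman_inequality (T := T) (G := G) (b := (η T)⁻¹ + 1)
    (f := fun k a ω => estimateGap A (pathSampling A ν γ η (X · ω) (L · ω) k) (L k ω) x a)
    (m := fun _ => 0) (v := fun k => (η k)⁻¹)
    (fun k a _ => measurable_estimateGap (fun y _ => measurable_pathSampling k y)
      (measurable_loss_preHistory le_rfl) x a)
    (add_pos (inv_pos.mpr (h.learning_pos T)) one_pos)
    (fun k hk => hL.mono fun ω hω a ha =>
      (abs_estimateGap_le (h.mul_pos k) (h.smul_one_le_secondMoment_pathSampling k) h.norm_le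
        (hω k) ha hx).trans (by rw [h.sq_div_mul]; linarith [h.inv_learning_le k hk]))
    (fun k _ => .of_forall fun ω => (sum_mul_estimateGap (h.mul_pos k)
      (h.smul_one_le_secondMoment_pathSampling k) (h.isDistribution_pathSampling k) _ _).le)
    (fun k _ => hL.mono fun ω hω => (sum_mul_sq_estimateGap_le (h.mul_pos k)
      (h.smul_one_le_secondMoment_pathSampling k) (h.isDistribution_pathSampling k) h.norm_le
      (hω k) hx).trans (h.sq_div_mul k).le) hG
  simpa only [Finset.sum_const_zero, zero_add] using hfreedman

lemma IsRun.le_measureReal_deviationBounds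
    (hL : ∀ᵐ ω ∂P, ∀ k, ∀ x ∈ A, |inner ℝ (L k ω) x| ≤ 1) (hG : 0 ≤ G) :
    1 - (A.card + 2) * Real.exp (-G) ≤
      P.real {ω | DeviationBounds A ν γ η T G (X · ω) (L · ω)} := by
  set D := {ω | DeviationBounds A ν γ η T G (X · ω) (L · ω)}
  have h₁ := hrun.measureReal_exploitGap_le h (T := T) hL hG
  have h₂ := hrun.measureReal_secondOrder_le h (T := T) hG
  have h₃ := fun x hx => hrun.measureReal_estimateGap_le h (T := T) (x := x) hL hG hx
  set E₁ := {ω | _ < ∑ k ∈ Finset.range T, exploitGap A (pathWeights A ν γ η (X · ω) (L · ω) k)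
    (pathSampling A ν γ η (X · ω) (L · ω) k) (L k ω) (X k ω)}
  set E₂ := {ω | _ < ∑ k ∈ Finset.range T,
    secondOrder A (pathSampling A ν γ η (X · ω) (L · ω) k) (γ k) (η k) (X k ω)}
  set E₃ : Vec n → Set Ω := fun x => {ω | √(2 * (∑ k ∈ Finset.range T, (η k)⁻¹) * G) +
    ((η T)⁻¹ + 1) * G < ∑ k ∈ Finset.range T,
      estimateGap A (pathSampling A ν γ η (X · ω) (L · ω) k) (L k ω) x (X k ω)}
  have hcover : Set.univ ⊆ D ∪ (E₁ ∪ (E₂ ∪ ⋃ x ∈ A, E₃ x)) := by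
    intro ω _
    by_contra hω
    simp only [Set.mem_union, not_or, Set.mem_iUnion, not_exists] at hω
    exact hω.1 ⟨not_lt.mp hω.2.1, not_lt.mp hω.2.2.1, fun x hx => not_lt.mp (hω.2.2.2 x hx)⟩
  have hE₃ : P.real (⋃ x ∈ A, E₃ x) ≤ A.card * Real.exp (-G) :=
    (measureReal_biUnion_finset_le A E₃).trans
      ((Finset.sum_le_card_nsmul A _ _ h₃).trans_eq (nsmul_eq_mul _ _))
  have huniv : 1 ≤ P.real (D ∪ (E₁ ∪ (E₂ ∪ ⋃ x ∈ A, E₃ x))) :=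
    probReal_univ (μ := P) ▸ measureReal_mono hcover
  linarith [measureReal_union_le (μ := P) D (E₁ ∪ (E₂ ∪ ⋃ x ∈ A, E₃ x)),
    measureReal_union_le (μ := P) E₁ (E₂ ∪ ⋃ x ∈ A, E₃ x),
    measureReal_union_le (μ := P) E₂ (⋃ x ∈ A, E₃ x)]

end Deviations

end Admissible

section Regret

variable {n : ℕ} {A : Finset (Vec n)} {ν : Vec n → ℝ} {B lam : ℝ} {γ η : ℕ → ℝ}
  {xs Ls : ℕ → Vec n} {T : ℕ}

lemma inner_pathEstimate (A : Finset (Vec n)) (ν : Vec n → ℝ) (γ η : ℕ → ℝ) (xs Ls : ℕ → Vec n)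
    (k : ℕ) (x : Vec n) : inner ℝ (pathEstimate A ν γ η xs Ls k) x = ∑ i ∈ Finset.range k,
      inner ℝ (lossEstimate A (pathSampling A ν γ η xs Ls i) (inner ℝ (Ls i) (xs i)) (xs i)) x := by
  induction k with
  | zero => exact inner_zero_left x
  | succ k ih =>
    rw [Finset.sum_range_succ, ← ih, ← inner_add_left]
    rfl

lemma pathWeights_eq_softmin (A : Finset (Vec n)) (ν : Vec n → ℝ) (γ η : ℕ → ℝ)
    (xs Ls : ℕ → Vec n) (k : ℕ) :
    pathWeights A ν γ η xs Ls k = softmin A (η k) fun x => ∑ i ∈ Finset.range k,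
      inner ℝ (lossEstimate A (pathSampling A ν γ η xs Ls i) (inner ℝ (Ls i) (xs i)) (xs i)) x := by
  simp only [← inner_pathEstimate]
  rfl

lemma IsAdmissible.sum_inner_sub_sum_inner_le (h : IsAdmissible A ν B lam γ η)
    (hxs : ∀ k, xs k ∈ A) (hL : ∀ k, ∀ x ∈ A, |inner ℝ (Ls k) x| ≤ 1) {x : Vec n} (hx : x ∈ A) :
    ∑ k ∈ Finset.range T, inner ℝ (Ls k) (xs k) - ∑ k ∈ Finset.range T, inner ℝ (Ls k) x ≤
      ∑ k ∈ Finset.range T, exploitGap A (pathWeights A ν γ η xs Ls k)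
        (pathSampling A ν γ η xs Ls k) (Ls k) (xs k) +
      (Real.exp 1 - 2) * ∑ k ∈ Finset.range T,
        secondOrder A (pathSampling A ν γ η xs Ls k) (γ k) (η k) (xs k) +
      ∑ k ∈ Finset.range T, estimateGap A (pathSampling A ν γ η xs Ls k) (Ls k) x (xs k) +
      Real.log A.card / η T := by
  set z : ℕ → Vec n → ℝ := fun k y =>
    inner ℝ (lossEstimate A (pathSampling A ν γ η xs Ls k) (inner ℝ (Ls k) (xs k)) (xs k)) y
  have hz (k : ℕ) (y : Vec n) (hy : y ∈ A) : |η k * z k y| ≤ 1 := by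
    rw [abs_mul, abs_of_pos (h.learning_pos k), ← h.learning_mul_sq_div k]
    exact mul_le_mul_of_nonneg_left (abs_inner_lossEstimate_le (h.mul_pos k)
      (h.smul_one_le_secondMoment_pathSampling k) (hL k _ (hxs k)) (h.norm_le _ (hxs k))
      (h.norm_le y hy)) (h.learning_pos k).le
  have hsecond (k : ℕ) : η k * ∑ y ∈ A, pathWeights A ν γ η xs Ls k y * z k y ^ 2 ≤
      secondOrder A (pathSampling A ν γ η xs Ls k) (γ k) (η k) (xs k) := by
    rw [secondOrder, mul_right_comm, mul_comm _ (η k)]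
    exact mul_le_mul_of_nonneg_left (sum_mul_sq_inner_lossEstimate_le_mul (h.mul_pos k)
      (h.smul_one_le_secondMoment_pathSampling k) (h.isDistribution_pathWeights k).nonneg
      (h.pathWeights_le k) (hL k _ (hxs k)) (xs k)) (h.learning_pos k).le
  have hweights := sum_softmin_mul_le h.learning_antitone h.learning_pos
    (fun k (_ : k < T) y hy => (abs_le.mp (hz k y hy)).1) hx
  simp only [z, ← pathWeights_eq_softmin] at hweights
  have hexp : 0 ≤ Real.exp 1 - 2 := by linarith [Real.exp_one_gt_two]
  have hsum := mul_le_mul_of_nonneg_left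
    (Finset.sum_le_sum fun k (_ : k ∈ Finset.range T) => hsecond k) hexp
  simp only [exploitGap, estimateGap, inner_mean, Finset.sum_sub_distrib]
  linarith

lemma regret_le {hA : A.Nonempty} {r : ℝ} (hr : ∀ x ∈ A, ∑ k ∈ Finset.range T,
    inner ℝ (Ls k) (xs k) - ∑ k ∈ Finset.range T, inner ℝ (Ls k) x ≤ r) :
    regret A hA xs Ls T ≤ r :=
  sub_le_comm.mp (Finset.le_inf' hA _ fun x hx => sub_le_comm.mp (hr x hx))

lemma regret_le_two_mul (hA : A.Nonempty) (hxs : ∀ k, xs k ∈ A)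
    (hL : ∀ k, ∀ x ∈ A, |inner ℝ (Ls k) x| ≤ 1) (T : ℕ) : regret A hA xs Ls T ≤ T * 2 := by
  refine regret_le fun x hx => ?_
  rw [← Finset.sum_sub_distrib, ← nsmul_eq_mul]
  refine (Finset.sum_le_card_nsmul _ _ 2 fun k _ => ?_).trans_eq (by rw [Finset.card_range])
  linarith [(abs_le.mp (hL k x hx)).1, (abs_le.mp (hL k _ (hxs k))).2]

lemma IsAdmissible.regret_le_of_deviationBounds (h : IsAdmissible A ν B lam γ η)
    (hA : A.Nonempty) (hxs : ∀ k, xs k ∈ A) (hL : ∀ k, ∀ x ∈ A, |inner ℝ (Ls k) x| ≤ 1) {G : ℝ}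
    (hdev : DeviationBounds A ν γ η T G xs Ls) :
    regret A hA xs Ls T ≤
      (∑ k ∈ Finset.range T, 2 * γ k + √(2 * (T * 6) * G) + ((η T)⁻¹ + 1) * G) +
      (Real.exp 1 - 2) *
        (∑ k ∈ Finset.range T, (1 - γ k)⁻¹ * η k * n + √(2 * (T * 4) * G) + 2 * G) +
      (√(2 * (∑ k ∈ Finset.range T, (η k)⁻¹) * G) + ((η T)⁻¹ + 1) * G) +
      Real.log A.card / η T := by
  have hexp : 0 ≤ Real.exp 1 - 2 := by linarith [Real.exp_one_gt_two]
  refine regret_le fun x hx => (h.sum_inner_sub_sum_inner_le hxs hL hx).trans ?_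
  gcongr
  exacts [hdev.exploit, hdev.secondOrder, hdev.estimate x hx]

end Regret

section Rates

open scoped MatrixOrder

variable {n : ℕ} {A : Finset (Vec n)} {ν : Vec n → ℝ} {B lam : ℝ}

lemma inv_explorationRate (k : ℕ) :
    (explorationRate k)⁻¹ = 2 * ((k : ℝ) + 1) ^ (1 / 3 : ℝ) := by
  rw [explorationRate, inv_div, Real.rpow_neg (by positivity), div_inv_eq_mul]

lemma explorationRate_pos (k : ℕ) : 0 < explorationRate k := by
  rw [explorationRate]
  positivity

lemma explorationRate_le_half (k : ℕ) : explorationRate k ≤ 1 / 2 :=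
  div_le_div_of_nonneg_right (Real.rpow_le_one_of_one_le_of_nonpos
    (le_add_of_nonneg_left k.cast_nonneg) (by norm_num)) two_pos.le

lemma explorationRate_antitone : Antitone explorationRate := fun i j hij => by
  rw [explorationRate, explorationRate]
  refine div_le_div_of_nonneg_right (Real.rpow_le_rpow_of_nonpos (by positivity) ?_
    (by norm_num)) two_pos.le
  gcongr

lemma isAdmissible_explorationRate (hB₀ : 0 < B) (hB : ∀ x ∈ A, ‖x‖ ≤ B) (hlam : 0 < lam)
    (hν : IsDistribution A ν) (hνC : lam • 1 ≤ secondMoment A ν) :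
    IsAdmissible A ν B lam explorationRate (learningRate lam B) :=
  ⟨hB, hB₀, hlam, hν, hνC, explorationRate_antitone, explorationRate_pos,
    explorationRate_le_half, fun _ => rfl⟩

lemma sum_explorationRate_le (T : ℕ) :
    ∑ k ∈ Finset.range T, explorationRate k ≤ 3 / 4 * (T : ℝ) ^ (2 / 3 : ℝ) := by
  have h := sum_rpow_sub_one_le (s := 2 / 3) (by norm_num) (by norm_num) T
  simp only [explorationRate, ← Finset.sum_div]
  norm_num at h ⊢
  linarith

lemma sum_sq_explorationRate_le (T : ℕ) :
    ∑ k ∈ Finset.range T, explorationRate k ^ 2 ≤ 3 / 4 * (T : ℝ) ^ (1 / 3 : ℝ) := by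
  have hterm (k : ℕ) : explorationRate k ^ 2 = ((k : ℝ) + 1) ^ (1 / 3 - 1 : ℝ) / 4 := by
    rw [explorationRate, div_pow, ← Real.rpow_mul_natCast (by positivity)]
    norm_num
  have h := sum_rpow_sub_one_le (s := 1 / 3) (by norm_num) (by norm_num) T
  simp only [hterm, ← Finset.sum_div]
  linarith

lemma inv_learningRate (lam B : ℝ) (k : ℕ) :
    (learningRate lam B k)⁻¹ = 2 * (B ^ 2 / lam) * ((k : ℝ) + 1) ^ (1 / 3 : ℝ) := by
  rw [learningRate, mul_div_assoc, mul_inv, inv_explorationRate, inv_div]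
  ring

lemma inv_learningRate_le (hlam : 0 < lam) {T : ℕ} (hT : 1 ≤ T) :
    (learningRate lam B T)⁻¹ ≤ 4 * (B ^ 2 / lam) * (T : ℝ) ^ (1 / 3 : ℝ) := by
  have hT' : (1 : ℝ) ≤ T := Nat.one_le_cast.mpr hT
  have hroot : ((T : ℝ) + 1) ^ (1 / 3 : ℝ) ≤ 2 * (T : ℝ) ^ (1 / 3 : ℝ) :=
    calc ((T : ℝ) + 1) ^ (1 / 3 : ℝ) ≤ (2 ^ (3 : ℝ) * T) ^ (1 / 3 : ℝ) := by
          gcongr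
          norm_num
          linarith
      _ = 2 * (T : ℝ) ^ (1 / 3 : ℝ) := by
          rw [Real.mul_rpow (by positivity) (by positivity), ← Real.rpow_mul two_pos.le]
          norm_num
  calc (learningRate lam B T)⁻¹ = 2 * (B ^ 2 / lam) * ((T : ℝ) + 1) ^ (1 / 3 : ℝ) :=
        inv_learningRate lam B T
    _ ≤ 2 * (B ^ 2 / lam) * (2 * (T : ℝ) ^ (1 / 3 : ℝ)) := by gcongr
    _ = 4 * (B ^ 2 / lam) * (T : ℝ) ^ (1 / 3 : ℝ) := by ring

lemma sum_inv_learningRate_le (hlam : 0 < lam) (T : ℕ) :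
    ∑ k ∈ Finset.range T, (learningRate lam B k)⁻¹ ≤
      2 * (B ^ 2 / lam) * (3 / 4 * (T : ℝ) ^ (4 / 3 : ℝ) + (T : ℝ) ^ (1 / 3 : ℝ)) := by
  have h := sum_rpow_le (s := 1 / 3) (by norm_num) T
  simp only [inv_learningRate, ← Finset.mul_sum]
  gcongr
  norm_num at h ⊢
  linarith

lemma sum_inv_one_sub_mul_learningRate_le (hlam : 0 < lam) (n T : ℕ) :
    ∑ k ∈ Finset.range T, (1 - explorationRate k)⁻¹ * learningRate lam B k * n ≤
      n * (lam / B ^ 2) *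
        (3 / 4 * (T : ℝ) ^ (2 / 3 : ℝ) + 3 / 2 * (T : ℝ) ^ (1 / 3 : ℝ)) := by
  have hfactor (k : ℕ) : (1 - explorationRate k)⁻¹ ≤ 1 + 2 * explorationRate k := by
    have hhalf := explorationRate_le_half k
    rw [inv_le_iff_one_le_mul₀ (by linarith)]
    nlinarith [explorationRate_pos k]
  calc ∑ k ∈ Finset.range T, (1 - explorationRate k)⁻¹ * learningRate lam B k * n
      ≤ ∑ k ∈ Finset.range T,
          (1 + 2 * explorationRate k) * learningRate lam B k * n := by
        have hη (k : ℕ) : 0 ≤ learningRate lam B k := by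
          have := explorationRate_pos k
          unfold learningRate
          positivity
        gcongr with k
        exacts [hη k, hfactor k]
    _ = n * (lam / B ^ 2) * (∑ k ∈ Finset.range T, explorationRate k +
          2 * ∑ k ∈ Finset.range T, explorationRate k ^ 2) := by
        rw [Finset.mul_sum, ← Finset.sum_add_distrib, Finset.mul_sum]
        exact Finset.sum_congr rfl fun k _ => by rw [learningRate]; ring
    _ ≤ _ := by
        refine mul_le_mul_of_nonneg_left ?_ (by positivity)
        linarith [sum_explorationRate_le T, sum_sq_explorationRate_le T]

end Rates

section Bounds

lemma sqrt_two_mul_le {T c G : ℝ} (hT : 0 ≤ T) (hG : 0 ≤ G) (hc : c ≤ 6) :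
    √(2 * (T * c) * G) ≤ 7 / 2 * (√T * √G) := by
  refine Real.sqrt_le_iff.mpr ⟨by positivity, ?_⟩
  rw [mul_pow, mul_pow, Real.sq_sqrt hT, Real.sq_sqrt hG]
  nlinarith [mul_nonneg hT hG]

lemma sqrt_two_mul_le_of_le_quartic {V κ G u r : ℝ} (hu : u ^ 2 = κ * G) (hu₁ : 1 ≤ u)
    (hr : 1 ≤ r) (hG : 0 ≤ G) (hV : V ≤ 2 * κ * (3 / 4 * r ^ 4 + r)) :
    √(2 * V * G) ≤ √3 * u * r ^ 2 + 2 * (u ^ 2 * r) := by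
  have hur : 1 ≤ u ^ 2 * r := one_le_mul_of_one_le_of_one_le (one_le_pow₀ hu₁) hr
  refine Real.sqrt_le_iff.mpr ⟨by positivity, ?_⟩
  calc 2 * V * G ≤ 2 * (2 * κ * (3 / 4 * r ^ 4 + r)) * G := by gcongr
    _ = √3 ^ 2 * u ^ 2 * r ^ 4 + 4 * (u ^ 2 * r) := by
        rw [hu, Real.sq_sqrt (by norm_num)]
        ring
    _ ≤ √3 ^ 2 * u ^ 2 * r ^ 4 + 4 * (u ^ 2 * r) ^ 2 := by
        gcongr
        exact le_self_pow₀ hur two_ne_zero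
    _ ≤ √3 ^ 2 * u ^ 2 * r ^ 4 + 4 * (u ^ 2 * r) ^ 2 + 4 * (√3 * u * r ^ 2) * (u ^ 2 * r) :=
        le_add_of_nonneg_right (by positivity)
    _ = (√3 * u * r ^ 2 + 2 * (u ^ 2 * r)) ^ 2 := by ring

lemma rpow_third_pow {T : ℝ} (hT : 0 ≤ T) (m : ℕ) :
    (T ^ (1 / 3 : ℝ)) ^ m = T ^ (m / 3 : ℝ) := by
  rw [← Real.rpow_mul_natCast hT, one_div_mul_eq_div]

variable {n : ℕ} {A : Finset (Vec n)} {ν : Vec n → ℝ} {B lam G : ℝ} {xs Ls : ℕ → Vec n} {T : ℕ}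

lemma sq_div_sqrt_mul_sqrt (hlam : 0 ≤ lam) (hG : 0 ≤ G) :
    (B / √lam * √G) ^ 2 = B ^ 2 / lam * G := by
  rw [mul_pow, div_pow, Real.sq_sqrt hlam, Real.sq_sqrt hG]

lemma one_le_div_sqrt (hB : 0 ≤ B) (hlam : 0 < lam) (hle : lam ≤ B ^ 2) : 1 ≤ B / √lam :=
  (one_le_div (Real.sqrt_pos.mpr hlam)).mpr (Real.sqrt_le_iff.mpr ⟨hB, hle⟩)

lemma one_le_div_sqrt_mul_sqrt (hB : 0 ≤ B) (hlam : 0 < lam) (hle : lam ≤ B ^ 2) (hG : 1 ≤ G) :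
    1 ≤ B / √lam * √G :=
  one_le_mul_of_one_le_of_one_le (one_le_div_sqrt hB hlam hle) (Real.one_le_sqrt.mpr hG)

lemma inv_learningRate_mul_le (hlam : 0 < lam) (hT : 1 ≤ T) (hG : 0 ≤ G) {c : ℝ} (hc : c ≤ G) :
    (learningRate lam B T)⁻¹ * c ≤ 4 * (B ^ 2 / lam * G * (T : ℝ) ^ (1 / 3 : ℝ)) := by
  have hη : 0 ≤ (learningRate lam B T)⁻¹ := by
    rw [inv_learningRate]
    positivity
  calc (learningRate lam B T)⁻¹ * c ≤ (4 * (B ^ 2 / lam) * (T : ℝ) ^ (1 / 3 : ℝ)) * G :=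
        (mul_le_mul_of_nonneg_left hc hη).trans
          (mul_le_mul_of_nonneg_right (inv_learningRate_le hlam hT) hG)
    _ = 4 * (B ^ 2 / lam * G * (T : ℝ) ^ (1 / 3 : ℝ)) := by ring

lemma sqrt_sum_inv_learningRate_le (hB : 0 ≤ B) (hlam : 0 < lam) (hle : lam ≤ B ^ 2)
    (hT : 1 ≤ T) (hG : 1 ≤ G) :
    √(2 * (∑ k ∈ Finset.range T, (learningRate lam B k)⁻¹) * G) ≤
      √3 * (B / √lam * √G) * (T : ℝ) ^ (2 / 3 : ℝ) +
        2 * (B ^ 2 / lam * G * (T : ℝ) ^ (1 / 3 : ℝ)) := by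
  have hG₀ : 0 ≤ G := zero_le_one.trans hG
  have hpow := rpow_third_pow (T.cast_nonneg (α := ℝ))
  have h := sqrt_two_mul_le_of_le_quartic (r := (T : ℝ) ^ (1 / 3 : ℝ))
    (sq_div_sqrt_mul_sqrt hlam.le hG₀) (one_le_div_sqrt_mul_sqrt hB hlam hle hG)
    (Real.one_le_rpow (Nat.one_le_cast.mpr hT) (by norm_num)) hG₀
    (V := ∑ k ∈ Finset.range T, (learningRate lam B k)⁻¹)
    (by simpa only [hpow, Nat.cast_ofNat] using sum_inv_learningRate_le hlam T)
  rwa [sq_div_sqrt_mul_sqrt hlam.le hG₀, hpow 2] at h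

lemma secondOrder_bound_le (hlam : 0 < lam) (hG : 0 ≤ G) (n T : ℕ) :
    (Real.exp 1 - 2) * (∑ k ∈ Finset.range T,
        (1 - explorationRate k)⁻¹ * learningRate lam B k * n + √(2 * (T * 4) * G) + 2 * G) ≤
      3 / 4 * (Real.exp 1 - 2) * (n * (lam / B ^ 2)) * (T : ℝ) ^ (2 / 3 : ℝ) +
        3 / 2 * (n * (lam / B ^ 2)) * (T : ℝ) ^ (1 / 3 : ℝ) + 7 / 2 * (√T * √G) + 2 * G := by
  have he₀ : 0 ≤ Real.exp 1 - 2 := by linarith [Real.exp_one_gt_two]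
  have he₁ : Real.exp 1 - 2 ≤ 1 := by linarith [Real.exp_one_lt_three]
  have hdrift := sum_inv_one_sub_mul_learningRate_le (B := B) hlam n T
  have hsqrt := sqrt_two_mul_le (c := 4) T.cast_nonneg hG (by norm_num)
  set s := 3 / 2 * (n * (lam / B ^ 2)) * (T : ℝ) ^ (1 / 3 : ℝ) + 7 / 2 * (√T * √G) + 2 * G with hs
  have hs₀ : 0 ≤ s := by positivity
  calc (Real.exp 1 - 2) * (∑ k ∈ Finset.range T,
        (1 - explorationRate k)⁻¹ * learningRate lam B k * n + √(2 * (T * 4) * G) + 2 * G)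
      ≤ (Real.exp 1 - 2) * (3 / 4 * (n * (lam / B ^ 2)) * (T : ℝ) ^ (2 / 3 : ℝ) + s) :=
        mul_le_mul_of_nonneg_left (by linarith) he₀
    _ = 3 / 4 * (Real.exp 1 - 2) * (n * (lam / B ^ 2)) * (T : ℝ) ^ (2 / 3 : ℝ) +
          (Real.exp 1 - 2) * s := by ring
    _ ≤ _ := by linarith [mul_le_of_le_one_left hs₀ he₁]

lemma rpow_third_le_sqrt (hT : 1 ≤ T) : (T : ℝ) ^ (1 / 3 : ℝ) ≤ √T := by
  rw [Real.sqrt_eq_rpow]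
  exact Real.rpow_le_rpow_of_exponent_le (Nat.one_le_cast.mpr hT) (by norm_num)

lemma sqrt_le_rpow_two_thirds (hT : 1 ≤ T) : √T ≤ (T : ℝ) ^ (2 / 3 : ℝ) := by
  rw [Real.sqrt_eq_rpow]
  exact Real.rpow_le_rpow_of_exponent_le (Nat.one_le_cast.mpr hT) (by norm_num)

lemma natCast_le_mul_rpow_two_thirds {u : ℝ} (hu : (T : ℝ) ^ (1 / 3 : ℝ) ≤ u) :
    (T : ℝ) ≤ u * (T : ℝ) ^ (2 / 3 : ℝ) :=
  calc (T : ℝ) = (T : ℝ) ^ (1 / 3 : ℝ) * (T : ℝ) ^ (2 / 3 : ℝ) := by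
        rw [← Real.rpow_add_of_nonneg T.cast_nonneg (by norm_num) (by norm_num)]
        norm_num
    _ ≤ u * (T : ℝ) ^ (2 / 3 : ℝ) := by gcongr

lemma regret_le_zero {A : Finset (Vec 0)} (hA : A.Nonempty) (xs Ls : ℕ → Vec 0) (T : ℕ) :
    regret A hA xs Ls T ≤ 0 :=
  regret_le fun x _ => by
    rw [← Finset.sum_sub_distrib]
    exact (Finset.sum_eq_zero fun k _ => by rw [Subsingleton.elim (xs k) x, sub_self]).le

section Deterministic

variable (h : IsAdmissible A ν B lam explorationRate (learningRate lam B)) (hle : lam ≤ B ^ 2)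
  (hA : A.Nonempty) (hxs : ∀ k, xs k ∈ A) (hL : ∀ k, ∀ x ∈ A, |inner ℝ (Ls k) x| ≤ 1)
  (hT : 1 ≤ T) (hG : 1 ≤ G) (hcard : Real.log A.card ≤ G)
  (hdev : DeviationBounds A ν explorationRate (learningRate lam B) T G xs Ls)

include h hle hxs hL hT hG hcard hdev

lemma regret_le_of_deviationBounds :
    regret A hA xs Ls T ≤
      (√3 * (B / √lam * √G) + 3 / 4 * (Real.exp 1 - 2) * (n * (lam / B ^ 2)) + 3 / 2) *
        (T : ℝ) ^ (2 / 3 : ℝ) +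
      (3 / 2 * (n * (lam / B ^ 2)) + 18 * (B ^ 2 / lam * G)) * (T : ℝ) ^ (1 / 3 : ℝ) +
      7 * (√T * √G) := by
  have hG₀ : 0 ≤ G := zero_le_one.trans hG
  have hGT : G ≤ B ^ 2 / lam * G * (T : ℝ) ^ (1 / 3 : ℝ) := by
    rw [mul_right_comm]
    exact le_mul_of_one_le_left hG₀ (one_le_mul_of_one_le_of_one_le
      ((one_le_div h.lam_pos).mpr hle) (Real.one_le_rpow (Nat.one_le_cast.mpr hT) (by norm_num)))
  have hregret := h.regret_le_of_deviationBounds hA hxs hL hdev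
  rw [← Finset.mul_sum, div_eq_inv_mul] at hregret
  linarith [sum_explorationRate_le T, sqrt_two_mul_le T.cast_nonneg hG₀ le_rfl,
    secondOrder_bound_le (B := B) h.lam_pos hG₀ n T,
    sqrt_sum_inv_learningRate_le h.bound_pos.le h.lam_pos hle hT hG,
    inv_learningRate_mul_le (B := B) h.lam_pos hT hG₀ le_rfl,
    inv_learningRate_mul_le (B := B) h.lam_pos hT hG₀ hcard]

lemma regret_le_add_mul_sqrt :
    regret A hA xs Ls T ≤
      (√3 * B / √lam * √G + n * (3 * (Real.exp 1 - 2) * lam / (4 * B ^ 2)) + 3 / 2) *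
        (T : ℝ) ^ (2 / 3 : ℝ) +
      18 * (n * (lam / B ^ 2) + (1 + B ^ 2 / lam) * G) * √T := by
  have hlam := h.lam_pos
  have hmain := regret_le_of_deviationBounds h hle hA hxs hL hT hG hcard hdev
  have hthird : (3 / 2 * (n * (lam / B ^ 2)) + 18 * (B ^ 2 / lam * G)) * (T : ℝ) ^ (1 / 3 : ℝ) ≤
      (3 / 2 * (n * (lam / B ^ 2)) + 18 * (B ^ 2 / lam * G)) * √T := by
    gcongr
    exact rpow_third_le_sqrt hT
  have hsqrt : √T * √G ≤ √T * G := by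
    gcongr
    exact Real.sqrt_le_iff.mpr ⟨by positivity, le_self_pow₀ hG two_ne_zero⟩
  have hν : 0 ≤ n * (lam / B ^ 2) * √T := by positivity
  have hcoeff : √3 * (B / √lam * √G) + 3 / 4 * (Real.exp 1 - 2) * (n * (lam / B ^ 2)) + 3 / 2 =
      √3 * B / √lam * √G + n * (3 * (Real.exp 1 - 2) * lam / (4 * B ^ 2)) + 3 / 2 := by ring
  rw [hcoeff] at hmain
  nlinarith [mul_nonneg (Real.sqrt_nonneg T) (zero_le_one.trans hG)]

lemma regret_le_rpow_two_thirds :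
    regret A hA xs Ls T ≤ 29 * (B / √lam * √G + n * (lam / B ^ 2)) * (T : ℝ) ^ (2 / 3 : ℝ) := by
  have hlam := h.lam_pos
  have hB := h.bound_pos
  have hmain := regret_le_of_deviationBounds h hle hA hxs hL hT hG hcard hdev
  have hpow₂ : ((T : ℝ) ^ (1 / 3 : ℝ)) ^ 2 = (T : ℝ) ^ (2 / 3 : ℝ) :=
    rpow_third_pow T.cast_nonneg 2
  have hu₁ := one_le_div_sqrt_mul_sqrt hB.le hlam hle hG
  rw [← sq_div_sqrt_mul_sqrt hlam.le (zero_le_one.trans hG)] at hmain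
  have hGu : √G ≤ B / √lam * √G :=
    le_mul_of_one_le_left (Real.sqrt_nonneg G) (one_le_div_sqrt hB.le hlam hle)
  set u := B / √lam * √G
  have hu : 0 ≤ u * (T : ℝ) ^ (2 / 3 : ℝ) := by positivity
  have hν : 0 ≤ n * (lam / B ^ 2) * (T : ℝ) ^ (2 / 3 : ℝ) := by positivity
  rcases le_total u ((T : ℝ) ^ (1 / 3 : ℝ)) with hur | hru
  · have hsqrt : √T * √G ≤ u * (T : ℝ) ^ (2 / 3 : ℝ) := by
      rw [mul_comm u]
      gcongr
      exact sqrt_le_rpow_two_thirds hT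
    have hquad : u ^ 2 * (T : ℝ) ^ (1 / 3 : ℝ) ≤ u * (T : ℝ) ^ (2 / 3 : ℝ) := by
      rw [sq, mul_assoc, ← hpow₂, sq]
      gcongr
    have hν₁ : n * (lam / B ^ 2) * (T : ℝ) ^ (1 / 3 : ℝ) ≤
        n * (lam / B ^ 2) * (T : ℝ) ^ (2 / 3 : ℝ) := by
      gcongr ?_ * ?_
      exact (rpow_third_le_sqrt hT).trans (sqrt_le_rpow_two_thirds hT)
    have hlead : (√3 * u + 3 / 4 * (Real.exp 1 - 2) * (n * (lam / B ^ 2)) + 3 / 2) *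
        (T : ℝ) ^ (2 / 3 : ℝ) ≤
        (2 * u + 3 / 4 * 1 * (n * (lam / B ^ 2)) + 3 / 2 * u) * (T : ℝ) ^ (2 / 3 : ℝ) := by
      gcongr
      · exact Real.sqrt_le_iff.mpr ⟨by norm_num, by norm_num⟩
      · linarith [Real.exp_one_lt_three]
      · exact le_mul_of_one_le_right (by norm_num) hu₁
    linarith
  · linarith [regret_le_two_mul hA hxs hL T, natCast_le_mul_rpow_two_thirds hru]

omit hle in
lemma regret_bounds_of_deviationBounds :
    regret A hA xs Ls T ≤
        (√3 * B / √lam * √G + n * (3 * (Real.exp 1 - 2) * lam / (4 * B ^ 2)) + 3 / 2) *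
          (T : ℝ) ^ (2 / 3 : ℝ) +
        18 * (n * (lam / B ^ 2) + (1 + B ^ 2 / lam) * G) * √T ∧
      regret A hA xs Ls T ≤ 29 * (B / √lam * √G + n * (lam / B ^ 2)) * (T : ℝ) ^ (2 / 3 : ℝ) := by
  have hlam := h.lam_pos
  have hB := h.bound_pos
  rcases n.eq_zero_or_pos with rfl | hn
  · simp only [Nat.cast_zero, zero_mul, zero_add, add_zero]
    exact ⟨(regret_le_zero hA xs Ls T).trans (by positivity),
      (regret_le_zero hA xs Ls T).trans (by positivity)⟩
  · have hle : lam ≤ B ^ 2 := (le_mul_of_one_le_left hlam.le (Nat.one_le_cast.mpr hn)).trans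
      (card_mul_le_sq h.smul_one_le h.isDistribution h.norm_le)
    exact ⟨regret_le_add_mul_sqrt h hle hA hxs hL hT hG hcard hdev,
      regret_le_rpow_two_thirds h hle hA hxs hL hT hG hcard hdev⟩

end Deterministic

end Bounds

lemma one_le_log_add_two_div {N δ : ℝ} (hN : 1 ≤ N) (hδ : 0 < δ) (hδ₁ : δ < 1) :
    1 ≤ Real.log ((N + 2) / δ) := by
  rw [Real.le_log_iff_exp_le (by positivity), le_div_iff₀ hδ]
  nlinarith [Real.exp_one_lt_three, Real.exp_pos 1]

lemma log_le_log_add_two_div {N δ : ℝ} (hN : 1 ≤ N) (hδ : 0 < δ) (hδ₁ : δ < 1) :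
    Real.log N ≤ Real.log ((N + 2) / δ) := by
  refine Real.log_le_log (by positivity) ?_
  rw [le_div_iff₀ hδ]
  nlinarith

lemma mul_exp_neg_log_div {a δ : ℝ} (ha : 0 < a) (hδ : 0 < δ) :
    a * Real.exp (-Real.log (a / δ)) = δ := by
  rw [Real.exp_neg, Real.exp_log (div_pos ha hδ), inv_div, mul_div_cancel₀ δ ha.ne']

end ComBand

theorem theorem2 :
    ∃ C₁ C₂ : ℝ, 0 < C₁ ∧ 0 < C₂ ∧
      ∀ (n : ℕ) (A : Finset (ComBand.Vec n)) (hA : A.Nonempty) (ν : ComBand.Vec n → ℝ) (B lam : ℝ),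
        0 < B → (∀ x ∈ A, ‖x‖ ≤ B) →
        0 < lam → ComBand.IsDistribution A ν →
        (ComBand.secondMoment A ν - lam • (1 : Matrix (Fin n) (Fin n) ℝ)).PosSemidef →
        ∀ (Ω : Type*) [MeasurableSpace Ω] (P : Measure Ω) [IsProbabilityMeasure P]
          (X L : ℕ → Ω → ComBand.Vec n),
          ComBand.IsRun A ν ComBand.explorationRate (ComBand.learningRate lam B) P X L →
          (∀ k, ∀ᵐ ω ∂P, ∀ x ∈ A, |inner ℝ (L k ω) x| ≤ 1) →
          ∀ (T : ℕ), 1 ≤ T → ∀ (δ : ℝ), 0 < δ → δ < 1 →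
            1 - δ ≤ P.real {ω |
              ComBand.regret A hA (fun k => X k ω) (fun k => L k ω) T ≤
                (√3 * B / √lam * √(Real.log ((A.card + 2) / δ))
                    + n * (3 * (Real.exp 1 - 2) * lam / (4 * B ^ 2)) + 3 / 2)
                  * (T : ℝ) ^ (2 / 3 : ℝ)
                + C₁ * (n * (lam / B ^ 2)
                    + (1 + B ^ 2 / lam) * Real.log ((A.card + 2) / δ)) * √T ∧
              ComBand.regret A hA (fun k => X k ω) (fun k => L k ω) T ≤
                C₂ * (B / √lam * √(Real.log ((A.card + 2) / δ)) + n * (lam / B ^ 2))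
                  * (T : ℝ) ^ (2 / 3 : ℝ)} := by
  refine ⟨18, 29, by norm_num, by norm_num, ?_⟩
  intro n A hA ν B lam hB₀ hB hlam hν hC Ω _ P _ X L hrun hL T hT δ hδ hδ₁
  have hadm := ComBand.isAdmissible_explorationRate hB₀ hB hlam hν (Matrix.le_iff.mpr hC)
  have hcard : (1 : ℝ) ≤ A.card := Nat.one_le_cast.mpr hA.card_pos
  have hG := ComBand.one_le_log_add_two_div hcard hδ hδ₁
  set G := Real.log ((A.card + 2) / δ)
  have hbounded := ae_all_iff.mpr hL
  calc 1 - δ = 1 - (A.card + 2) * Real.exp (-G) := by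
        rw [ComBand.mul_exp_neg_log_div (by positivity) hδ]
    _ ≤ P.real {ω | ComBand.DeviationBounds A ν ComBand.explorationRate
          (ComBand.learningRate lam B) T G (X · ω) (L · ω)} :=
        hrun.le_measureReal_deviationBounds hadm hbounded (zero_le_one.trans hG)
    _ ≤ _ := ENNReal.toReal_mono (measure_ne_top _ _) <| measure_mono_ae <|
        hbounded.mono fun ω hω hdev =>
          ComBand.regret_bounds_of_deviationBounds hadm hA (hrun.action_mem · ω) hω hT hG
            (ComBand.log_le_log_add_two_div hcard hδ hδ₁) hdev
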